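/- Let $k$ be a field, let $a\ge 1$, $b\in\{1,2,3\}$ and $d\ge 1$ be integers, and put $m_0=3a+b$ and $m_i=m_0+id$ for $i=1,2,3$; assume $\gcd(m_0,m_1,m_2,m_3)=1$. Let $A=k[[t^{m_0},t^{m_1},t^{m_2},t^{m_3}]]$, with maximal ideal $\mathfrak m=(t^{m_0},t^{m_1},t^{m_2},t^{m_3})$, and let $G=\operatorname{gr}_{\mathfrak m}(A)=\bigoplus_{i\ge 0}\mathfrak m^i/\mathfrak m^{i+1}$. Let $R=k[x_0,x_1,x_2,y]$ with its standard grading, and regard $G$ as a graded $R$-module through the $k$-algebra homomorphism $R\to G$ that sends $x_0,x_1,x_2,y$ to the classes of $t^{m_0},t^{m_1},t^{m_2},t^{m_3}$ in $\mathfrak m/\mathfrak m^2$. Put $g_1=x_1^2-x_0x_2$, $g_2=x_1x_2-x_0y$, $g_3=x_2^2-x_1y$. Then, together with the homomorphism $R\to G$, the following is a minimal graded free resolution of $G$; that is, the augmented sequence $0\to F_3\to F_2\to F_1\to R\to G\to 0$ is exact, all maps are homogeneous of degree $0$, and each $\phi_i$ maps into $(x_0,x_1,x_2,y)$ times its target.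 The matrices act on column vectors; the shifts of the basis elements are listed in the order of the columns of the matrices. **If $b=1$:** $$0\to R(-(a+3))^3\xrightarrow{\phi_3}R(-3)^2\oplus R(-(a+2))^6\xrightarrow{\phi_2}R(-2)^3\oplus R(-(a+1))^3\xrightarrow{\phi_1}R,$$ where $F_1$ has basis degrees $(2,2,2,a+1,a+1,a+1)$, $F_2$ has basis degrees $(3,a+2,3,a+2,a+2,a+2,a+2,a+2)$, $$\phi_1=\begin{pmatrix}g_1&g_2&g_3&x_1y^a&x_2y^a&y^{a+1}\end{pmatrix},$$ $$\phi_2=\begin{pmatrix}x_2&y^a&-y&0&0&0&0&0\\-x_1&0&x_2&y^a&0&0&0&0\\x_0&0&-x_1&0&y^a&0&0&0\\0&-x_1&0&-x_2&0&x_2&y&0\\0&x_0&0&0&-x_2&-x_1&0&y\\0&0&0&x_0&x_1&0&-x_1&-x_2\end{pmatrix},\qquad \phi_3=\begin{pmatrix}y^a&0&0\\-x_2&y&0\\0&y^a&0\\x_1&-x_2&0\\-x_0&x_1&0\\0&-x_2&y\\0&x_1&-x_2\\0&-x_0&x_1\end{pmatrix}.$$ **If $b=2$:** $$0\to R(-(a+4))\xrightarrow{\phi_3}R(-3)^2\oplus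 R(-(a+2))^3\xrightarrow{\phi_2}R(-2)^3\oplus R(-(a+1))^2\xrightarrow{\phi_1}R,$$ where $F_1$ has basis degrees $(2,2,2,a+1,a+1)$, $F_2$ has basis degrees $(3,3,a+2,a+2,a+2)$, $$\phi_1=\begin{pmatrix}g_1&g_2&g_3&x_2y^a&y^{a+1}\end{pmatrix},\qquad \phi_2=\begin{pmatrix}x_2&-y&0&0&0\\-x_1&x_2&y^a&0&0\\x_0&-x_1&0&y^a&0\\0&0&-x_1&-x_2&y\\0&0&x_0&x_1&-x_2\end{pmatrix},\qquad \phi_3=\begin{pmatrix}y^{a+1}\\x_2y^a\\-g_3\\g_2\\g_1\end{pmatrix}.$$ **If $b=3$:** $$0\to R(-(a+4))^2\xrightarrow{\phi_3}R(-3)^2\oplus R(-(a+3))^3\xrightarrow{\phi_2}R(-2)^3\oplus R(-(a+1))\xrightarrow{\phi_1}R,$$ where $F_1$ has basis degrees $(2,2,2,a+1)$, $F_2$ has basis degrees $(3,a+3,3,a+3,a+3)$, $$\phi_1=\begin{pmatrix}g_1&g_2&g_3&y^{a+1}\end{pmatrix},\qquad \phi_2=\begin{pmatrix}x_2&y^{a+1}&-y&0&0\\-x_1&0&x_2&y^{a+1}&0\\x_0&0&-x_1&0&y^{a+1}\\0&-g_1&0&-g_2&-g_3\end{pmatrix},\qquad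 \phi_3=\begin{pmatrix}y^{a+1}&0\\-x_2&y\\0&y^{a+1}\\x_1&-x_2\\-x_0&x_1\end{pmatrix}.$$ -/

import Mathlib

open MvPolynomial

noncomputable section

namespace MonomialCurve

/-! ### The associated graded ring of an ideal -/

/-- The associated graded ring `gr_I(A) = ⨁ₙ Iⁿ / Iⁿ⁺¹` of a commutative ring `A` with respect to
an ideal `I`, realised as the quotient of the Rees algebra `⨁ₙ Iⁿ Tⁿ ⊆ A[T]` by the ideal that `I`
generates in it. -/
abbrev AssociatedGraded {A : Type*} [CommRing A] (I : Ideal A) : Type _ :=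
  reesAlgebra I ⧸ I.map (algebraMap A (reesAlgebra I))

/-- The canonical `A`-linear map `Iⁿ → gr_I(A)`, `f ↦ f Tⁿ`. -/
def AssociatedGraded.cls {A : Type*} [CommRing A] (I : Ideal A) (n : ℕ) :
    ↥(I ^ n) →ₗ[A] AssociatedGraded I where
  toFun f := Ideal.Quotient.mk (I.map (algebraMap A (reesAlgebra I)))
    ⟨Polynomial.monomial n (f : A), reesAlgebra.monomial_mem.mpr f.2⟩
  map_add' f g := by
    rw [← map_add]
    congr 1
    ext1
    simp
  map_smul' c f := by
    rw [RingHom.id_apply, ← Ideal.Quotient.mkₐ_eq_mk A, ← map_smul]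
    congr 1
    ext1
    simp [Polynomial.smul_monomial]

/-- The kernel of `Iⁿ → gr_I(A)` is `Iⁿ⁺¹`, so its range is a copy of `Iⁿ / Iⁿ⁺¹`. -/
theorem AssociatedGraded.cls_eq_zero_iff {A : Type*} [CommRing A] (I : Ideal A) (n : ℕ)
    (f : ↥(I ^ n)) : AssociatedGraded.cls I n f = 0 ↔ (f : A) ∈ I ^ (n + 1) := by
  have key : ∀ p ∈ I.map (algebraMap A (reesAlgebra I)),
      ∀ n, (p : Polynomial A).coeff n ∈ I ^ (n + 1) := by
    intro p hp
    refine Submodule.span_induction (R := reesAlgebra I)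
      (p := fun (q : reesAlgebra I) _ => ∀ n, (q : Polynomial A).coeff n ∈ I ^ (n + 1)) ?_ ?_ ?_ ?_ hp
    · rintro _ ⟨c, hc, rfl⟩ n
      change (Polynomial.C c).coeff n ∈ _
      rw [Polynomial.coeff_C]
      split_ifs with h
      · subst h
        simpa using hc
      · exact Ideal.zero_mem _
    · simp
    · intro x y _ _ hx hy n
      simpa using Ideal.add_mem _ (hx n) (hy n)
    · intro r x _ hx n
      change ((r : Polynomial A) * (x : Polynomial A)).coeff n ∈ _
      rw [Polynomial.coeff_mul]
      refine Ideal.sum_mem _ fun q hq => ?_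
      rw [← Finset.HasAntidiagonal.mem_antidiagonal.mp hq, add_assoc, pow_add]
      exact Ideal.mul_mem_mul (r.2 q.1) (hx q.2)
  change Ideal.Quotient.mk _ _ = 0 ↔ _
  rw [Ideal.Quotient.eq_zero_iff_mem]
  constructor
  · intro h
    simpa using key _ h n
  · obtain ⟨f, hf⟩ := f
    intro h
    change f ∈ I ^ (n + 1) at h
    suffices H : ∃ hf' : Polynomial.monomial n f ∈ reesAlgebra I,
        (⟨Polynomial.monomial n f, hf'⟩ : reesAlgebra I) ∈
          I.map (algebraMap A (reesAlgebra I)) from H.2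
    rw [pow_succ'] at h
    refine Submodule.mul_induction_on h ?_ ?_
    · intro u hu v hv
      refine ⟨reesAlgebra.monomial_mem.mpr (Ideal.mul_mem_left _ _ hv), ?_⟩
      convert Ideal.mul_mem_right (⟨Polynomial.monomial n v, reesAlgebra.monomial_mem.mpr hv⟩ :
        reesAlgebra I) _ (Ideal.mem_map_of_mem (algebraMap A (reesAlgebra I)) hu) using 1
      ext1
      exact (Polynomial.C_mul_monomial).symm
    · rintro u v ⟨hu, hu'⟩ ⟨hv, hv'⟩
      refine ⟨by rw [map_add]; exact add_mem hu hv, ?_⟩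
      convert Ideal.add_mem _ hu' hv' using 1
      ext1
      exact map_add _ _ _

/-- The homogeneous component `Iⁿ / Iⁿ⁺¹` of `gr_I(A)`, as a `k`-subspace. -/
def AssociatedGraded.component (k : Type*) {A : Type*} [CommRing k] [CommRing A] [Algebra k A]
    (I : Ideal A) (n : ℕ) : Submodule k (AssociatedGraded I) where
  carrier := Set.range (AssociatedGraded.cls I n)
  add_mem' := by
    rintro _ _ ⟨f, rfl⟩ ⟨g, rfl⟩
    exact ⟨f + g, map_add _ _ _⟩
  zero_mem' := ⟨0, map_zero _⟩
  smul_mem' := by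
    rintro c _ ⟨f, rfl⟩
    refine ⟨algebraMap k A c • f, ?_⟩
    rw [map_smul, algebraMap_smul]

/-! ### The local ring of the monomial curve and its associated graded ring -/

/-- The ring `k[[t^{m 0}, t^{m 1}, t^{m 2}, t^{m 3}]]`: the power series in `t` all of whose
exponents lie in the numerical semigroup generated by the `m i`. -/
def localRing (k : Type*) [Field k] (m : Fin 4 → ℕ) : Subalgebra k (PowerSeries k) where
  carrier := {f | ∀ n, PowerSeries.coeff n f ≠ 0 → n ∈ AddSubmonoid.closure (Set.range m)}
  mul_mem' := by
    intro f g hf hg n hn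
    rw [PowerSeries.coeff_mul] at hn
    obtain ⟨p, hp, hne⟩ := Finset.exists_ne_zero_of_sum_ne_zero hn
    rw [← Finset.HasAntidiagonal.mem_antidiagonal.mp hp]
    exact add_mem (hf _ (left_ne_zero_of_mul hne)) (hg _ (right_ne_zero_of_mul hne))
  add_mem' := by
    intro f g hf hg n hn
    by_cases h : PowerSeries.coeff n f = 0
    · exact hg n (fun h' => hn (by rw [map_add, h, h', add_zero]))
    · exact hf n h
  algebraMap_mem' := by
    intro c n hn
    by_cases h : n = 0
    · rw [h]
      exact zero_mem _
    · refine absurd ?_ hn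
      change PowerSeries.coeff n (PowerSeries.C c) = 0
      rw [PowerSeries.coeff_C, if_neg h]

/-- The element `t^{m i}` of the local ring. -/
def tPow (k : Type*) [Field k] (m : Fin 4 → ℕ) (i : Fin 4) : localRing k m :=
  ⟨PowerSeries.monomial (m i) 1, by
    intro n hn
    by_cases h : n = m i
    · rw [h]
      exact AddSubmonoid.subset_closure ⟨i, rfl⟩
    · exact absurd (by rw [PowerSeries.coeff_monomial, if_neg h]) hn⟩

/-- The maximal ideal `𝔪 = (t^{m 0}, t^{m 1}, t^{m 2}, t^{m 3})`. -/
def maxIdeal (k : Type*) [Field k] (m : Fin 4 → ℕ) : Ideal (localRing k m) :=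
  Ideal.span (Set.range (tPow k m))

/-- The associated graded ring `G = gr_𝔪(k[[t^{m 0}, t^{m 1}, t^{m 2}, t^{m 3}]])`. -/
abbrev G (k : Type*) [Field k] (m : Fin 4 → ℕ) : Type _ := AssociatedGraded (maxIdeal k m)

/-- The component `𝔪ⁿ / 𝔪ⁿ⁺¹` of `G`. -/
def gComponent (k : Type*) [Field k] (m : Fin 4 → ℕ) (n : ℕ) : Submodule k (G k m) :=
  AssociatedGraded.component k (maxIdeal k m) n

/-- The canonical homomorphism of `k`-algebras `k[x₀, x₁, x₂, y] → G` that sends the variables to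
the classes of `t^{m 0}, t^{m 1}, t^{m 2}, t^{m 3}` in `𝔪 / 𝔪²`. -/
def toG (k : Type*) [Field k] (m : Fin 4 → ℕ) : MvPolynomial (Fin 4) k →ₐ[k] G k m :=
  aeval fun i => AssociatedGraded.cls (maxIdeal k m) 1
    ⟨tPow k m i, by
      rw [pow_one]
      exact Ideal.subset_span ⟨i, rfl⟩⟩

/-! ### Minimal graded free resolutions over `R = k[x₀, x₁, x₂, y]` -/

/-- The homogeneous component of degree `n` of the graded free module `⨁ᵢ R(-s i)`: the vectors
whose `i`-th entry is homogeneous of degree `n - s i` (and is zero if `n < s i`). -/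
def freeComponent (k : Type*) [Field k] {r : ℕ} (s : Fin r → ℕ) (n : ℕ) :
    Submodule k (Fin r → MvPolynomial (Fin 4) k) where
  carrier := {v | ∀ (i : Fin r) (e : Fin 4 →₀ ℕ), coeff e (v i) ≠ 0 → e.degree + s i = n}
  add_mem' := by
    intro v w hv hw i e he
    by_cases h : coeff e (v i) = 0
    · exact hw i e (fun h' => he (by rw [Pi.add_apply, coeff_add, h, h', add_zero]))
    · exact hv i e h
  zero_mem' := by
    intro i e he
    exact absurd (by simp) he
  smul_mem' := by
    intro c v hv i e he
    refine hv i e fun h => he ?_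
    rw [Pi.smul_apply, coeff_smul, h, smul_zero]

/-- The homogeneous maximal ideal `(x₀, x₁, x₂, y)` of `R`. -/
def irrelevantIdeal (k : Type*) [Field k] : Ideal (MvPolynomial (Fin 4) k) :=
  Ideal.span (Set.range X)

/-- Let `B` be a `k`-algebra with homogeneous components `ℬ n`, regarded as an `R`-module through a
homomorphism `π : R → B`. The complex
`0 → ⨁ᵢ R(-s₃ i) → ⨁ᵢ R(-s₂ i) → ⨁ᵢ R(-s₁ i) → R → B → 0`,
with the maps `φ₃, φ₂, φ₁` (matrices acting on column vectors; `R` is written as `R¹`) and `π`, is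
a minimal graded free resolution of `B`: all maps are homogeneous of degree `0`, the sequence is
exact, and each `φᵢ` maps into `(x₀, x₁, x₂, y)` times its target. -/
structure IsMinimalGradedFreeResolution {k : Type*} [Field k] {B : Type*} [CommRing B]
    [Algebra k B] (ℬ : ℕ → Submodule k B) (π : MvPolynomial (Fin 4) k →ₐ[k] B)
    {r₁ r₂ r₃ : ℕ} (s₁ : Fin r₁ → ℕ) (s₂ : Fin r₂ → ℕ) (s₃ : Fin r₃ → ℕ)
    (φ₁ : Matrix (Fin 1) (Fin r₁) (MvPolynomial (Fin 4) k))
    (φ₂ : Matrix (Fin r₁) (Fin r₂) (MvPolynomial (Fin 4) k))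
    (φ₃ : Matrix (Fin r₂) (Fin r₃) (MvPolynomial (Fin 4) k)) : Prop where
  homogeneous_π : ∀ n, ∀ v ∈ freeComponent k ![0] n, π (v 0) ∈ ℬ n
  homogeneous_φ₁ : ∀ n, ∀ v ∈ freeComponent k s₁ n, φ₁.mulVecLin v ∈ freeComponent k ![0] n
  homogeneous_φ₂ : ∀ n, ∀ v ∈ freeComponent k s₂ n, φ₂.mulVecLin v ∈ freeComponent k s₁ n
  homogeneous_φ₃ : ∀ n, ∀ v ∈ freeComponent k s₃ n, φ₃.mulVecLin v ∈ freeComponent k s₂ n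
  surjective_π : Function.Surjective π
  exact_φ₁_π : Function.Exact φ₁.mulVecLin fun v => π (v 0)
  exact_φ₂_φ₁ : Function.Exact φ₂.mulVecLin φ₁.mulVecLin
  exact_φ₃_φ₂ : Function.Exact φ₃.mulVecLin φ₂.mulVecLin
  injective_φ₃ : Function.Injective φ₃.mulVecLin
  minimal_φ₁ : LinearMap.range φ₁.mulVecLin ≤ irrelevantIdeal k • ⊤
  minimal_φ₂ : LinearMap.range φ₂.mulVecLin ≤ irrelevantIdeal k • ⊤
  minimal_φ₃ : LinearMap.range φ₃.mulVecLin ≤ irrelevantIdeal k • ⊤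

/-! ### The matrices of the resolutions

`X 0, X 1, X 2, X 3` are the variables `x₀, x₁, x₂, y`. -/

/-- `x₁² - x₀x₂` -/
def g₁ (k : Type*) [Field k] : MvPolynomial (Fin 4) k := X 1 ^ 2 - X 0 * X 2

/-- `x₁x₂ - x₀y` -/
def g₂ (k : Type*) [Field k] : MvPolynomial (Fin 4) k := X 1 * X 2 - X 0 * X 3

/-- `x₂² - x₁y` -/
def g₃ (k : Type*) [Field k] : MvPolynomial (Fin 4) k := X 2 ^ 2 - X 1 * X 3

/-- `φ₁` for `b = 1`. -/
def phi₁One (k : Type*) [Field k] (a : ℕ) : Matrix (Fin 1) (Fin 6) (MvPolynomial (Fin 4) k) :=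
  !![g₁ k, g₂ k, g₃ k, X 1 * X 3 ^ a, X 2 * X 3 ^ a, X 3 ^ (a + 1)]

/-- `φ₂` for `b = 1`. -/
def phi₂One (k : Type*) [Field k] (a : ℕ) : Matrix (Fin 6) (Fin 8) (MvPolynomial (Fin 4) k) :=
  !![X 2, X 3 ^ a, -X 3, 0, 0, 0, 0, 0;
     -X 1, 0, X 2, X 3 ^ a, 0, 0, 0, 0;
     X 0, 0, -X 1, 0, X 3 ^ a, 0, 0, 0;
     0, -X 1, 0, -X 2, 0, X 2, X 3, 0;
     0, X 0, 0, 0, -X 2, -X 1, 0, X 3;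
     0, 0, 0, X 0, X 1, 0, -X 1, -X 2]

/-- `φ₃` for `b = 1`. -/
def phi₃One (k : Type*) [Field k] (a : ℕ) : Matrix (Fin 8) (Fin 3) (MvPolynomial (Fin 4) k) :=
  !![X 3 ^ a, 0, 0;
     -X 2, X 3, 0;
     0, X 3 ^ a, 0;
     X 1, -X 2, 0;
     -X 0, X 1, 0;
     0, -X 2, X 3;
     0, X 1, -X 2;
     0, -X 0, X 1]

/-- `φ₁` for `b = 2`. -/
def phi₁Two (k : Type*) [Field k] (a : ℕ) : Matrix (Fin 1) (Fin 5) (MvPolynomial (Fin 4) k) :=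
  !![g₁ k, g₂ k, g₃ k, X 2 * X 3 ^ a, X 3 ^ (a + 1)]

/-- `φ₂` for `b = 2`. -/
def phi₂Two (k : Type*) [Field k] (a : ℕ) : Matrix (Fin 5) (Fin 5) (MvPolynomial (Fin 4) k) :=
  !![X 2, -X 3, 0, 0, 0;
     -X 1, X 2, X 3 ^ a, 0, 0;
     X 0, -X 1, 0, X 3 ^ a, 0;
     0, 0, -X 1, -X 2, X 3;
     0, 0, X 0, X 1, -X 2]

/-- `φ₃` for `b = 2`. -/
def phi₃Two (k : Type*) [Field k] (a : ℕ) : Matrix (Fin 5) (Fin 1) (MvPolynomial (Fin 4) k) :=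
  !![X 3 ^ (a + 1); X 2 * X 3 ^ a; -g₃ k; g₂ k; g₁ k]

/-- `φ₁` for `b = 3`. -/
def phi₁Three (k : Type*) [Field k] (a : ℕ) : Matrix (Fin 1) (Fin 4) (MvPolynomial (Fin 4) k) :=
  !![g₁ k, g₂ k, g₃ k, X 3 ^ (a + 1)]

/-- `φ₂` for `b = 3`. -/
def phi₂Three (k : Type*) [Field k] (a : ℕ) : Matrix (Fin 4) (Fin 5) (MvPolynomial (Fin 4) k) :=
  !![X 2, X 3 ^ (a + 1), -X 3, 0, 0;
     -X 1, 0, X 2, X 3 ^ (a + 1), 0;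
     X 0, 0, -X 1, 0, X 3 ^ (a + 1);
     0, -g₁ k, 0, -g₂ k, -g₃ k]

/-- `φ₃` for `b = 3`. -/
def phi₃Three (k : Type*) [Field k] (a : ℕ) : Matrix (Fin 5) (Fin 2) (MvPolynomial (Fin 4) k) :=
  !![X 3 ^ (a + 1), 0;
     -X 2, X 3;
     0, X 3 ^ (a + 1);
     X 1, -X 2;
     -X 0, X 1]

end MonomialCurve

end

open MonomialCurve

/-! Two things have to be shown: the kernel of R → G is the ideal generated by the entries of `φ₁`,
and the matrices form an exact complex.

Kernel. With y regarded as x₃, the claim is that the kernel is generated by g₁, g₂, g₃ and the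
monomials xᵣ yᵃ with r ≥ b (`relationIdeal`). The binomials vanish in G because both terms have the
same degree and the same exponent of t. The monomials vanish because m_r + a m₃ = (a + d) m₀ +
m_{r-b}, which rewrites a product of a + 1 generators as one of a + d + 1. Conversely, give xᵢ
weight i. Modulo the binomials a monomial depends only on its degree n and weight w, and it lies in
the relation ideal once w ≥ 3a + b = m₀ (`monomial_sub_normalMonomial_mem`,
`normalMonomial_mem_relationIdeal`). For w < m₀, the sum of the coefficients of p in degree n and
weight w is the coefficient of t^(n m₀ + w d) in the n-th component of the image of p in the Rees
algebra. If p maps to 0 in G, that component lies in 𝔪ⁿ⁺¹. All exponents occurring in 𝔪ⁿ⁺¹ are n' m₀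
+ w' d with n' > n, and coprimality of m₀ and d excludes n m₀ + w d
(`coeff_eq_zero_of_mem_pow_succ`). So all these sums vanish.

Exactness. The gᵢ are the maximal minors of a 3 × 2 matrix, so their syzygies are generated by its
columns, by Hilbert–Burch (`exists_of_minors_syzygy`). Moreover y is a nonzerodivisor modulo (g₁,
g₂, g₃) (`exists_of_X_mul_eq`). A syzygy of `φ₁` therefore puts the cofactor of the power of y into
(g₁, g₂, g₃); Koszul relations among x₁, x₂, y and Hilbert–Burch then determine it. At the next
stage, the two Hilbert–Burch columns contain a 2 × 2 block of determinant g₃, which determines the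
remaining coordinates. -/

namespace MonomialCurve

/-! ### Syzygies of the minors g₁, g₂, g₃ and of the variables -/

/-- The maximal minors of `!![x₂, -y; -x₁, x₂; x₀, -x₁]` have only the syzygies given by its
columns, provided that the first and the third of these minors are coprime. -/
theorem exists_of_minors_syzygy {R : Type*} [CommRing R] [IsDomain R] {x₀ x₁ x₂ y u v w : R}
    (h₀ : x₁ ^ 2 - x₀ * x₂ ≠ 0)
    (hcop : ∀ z, x₁ ^ 2 - x₀ * x₂ ∣ (x₂ ^ 2 - x₁ * y) * z → x₁ ^ 2 - x₀ * x₂ ∣ z)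
    (h : u * (x₁ ^ 2 - x₀ * x₂) + v * (x₁ * x₂ - x₀ * y) + w * (x₂ ^ 2 - x₁ * y) = 0) :
    ∃ s t, u = x₂ * s - y * t ∧ v = -x₁ * s + x₂ * t ∧ w = x₀ * s - x₁ * t := by
  -- Modulo g₁ the minors satisfy x₂ g₂ ≡ x₁ g₃ and x₁ g₂ ≡ x₀ g₃, so x₂ or x₁ times the relation
  -- becomes g₃ times a linear form in v and w. The two forms have determinant g₁, and Cramer's rule
  -- recovers v and w.
  obtain ⟨s, hs⟩ := hcop (x₁ * v + x₂ * w) ⟨-(x₂ * u + y * v), by linear_combination x₂ * h⟩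
  obtain ⟨t, ht⟩ := hcop (x₀ * v + x₁ * w) ⟨-(x₂ * v + x₁ * u), by linear_combination x₁ * h⟩
  refine ⟨-s, -t, ?_, ?_, ?_⟩
  · refine mul_left_cancel₀ h₀ ?_
    linear_combination h - x₂ * hs + y * ht
  · refine mul_left_cancel₀ h₀ ?_
    linear_combination x₁ * hs - x₂ * ht
  · refine mul_left_cancel₀ h₀ ?_
    linear_combination -x₀ * hs + x₁ * ht

/-- The substitution `xᵢ ↦ 0`. -/
noncomputable def kill (k : Type*) [Field k] (i : Fin 4) :
    MvPolynomial (Fin 4) k →ₐ[k] MvPolynomial (Fin 4) k :=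
  aeval (Function.update X i 0)

section

variable {k : Type*} [Field k]

theorem kill_X_self (i : Fin 4) : kill k i (X i) = 0 := by
  simp [kill]

theorem kill_X_of_ne {i j : Fin 4} (h : j ≠ i) : kill k i (X j) = X j := by
  simp [kill, h]

theorem exists_eq_kill_add (i : Fin 4) (f : MvPolynomial (Fin 4) k) :
    ∃ c, f = kill k i f + X i * c := by
  induction f using MvPolynomial.induction_on with
  | C r => exact ⟨0, by simp [kill]⟩
  | add p q hp hq =>
    obtain ⟨c, hc⟩ := hp
    obtain ⟨e, he⟩ := hq
    exact ⟨c + e, by rw [map_add]; linear_combination hc + he⟩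
  | mul_X p j hp =>
    obtain ⟨c, hc⟩ := hp
    by_cases h : j = i
    · subst h
      exact ⟨p, by rw [map_mul, kill_X_self]; ring⟩
    · exact ⟨c * X j, by rw [map_mul, kill_X_of_ne h]; linear_combination X j * hc⟩

theorem g₁_ne_zero : (X 1 ^ 2 - X 0 * X 2 : MvPolynomial (Fin 4) k) ≠ 0 := by
  intro h
  simpa using congrArg (eval ![0, 1, 0, 0]) h

theorem g₃_ne_zero : (X 2 ^ 2 - X 1 * X 3 : MvPolynomial (Fin 4) k) ≠ 0 := by
  intro h
  simpa using congrArg (eval ![0, 0, 1, 0]) h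

/-- The polynomial is linear in x₀ with relatively prime coefficients -x₂ and x₁², hence irreducible
in a factorial ring. -/
theorem prime_g₁ : Prime (X 1 ^ 2 - X 0 * X 2 : MvPolynomial (Fin 4) k) := by
  rw [← UniqueFactorizationMonoid.irreducible_iff_prime]
  have : (X 1 ^ 2 - X 0 * X 2 : MvPolynomial (Fin 4) k) = -X 2 * X 0 + X 1 ^ 2 := by ring
  rw [this]
  refine irreducible_mul_X_add _ _ _ (neg_ne_zero.mpr (X_ne_zero _)) ?_ ?_ ?_
  · rw [vars_neg, vars_X]
    decide
  · intro h
    have := vars_pow _ _ h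
    rw [vars_X] at this
    exact absurd this (by decide)
  · rw [IsRelPrime.neg_left_iff, (X_prime (i := (2 : Fin 4))).irreducible.isRelPrime_iff_not_dvd]
    intro h
    have := (X_prime (i := (2 : Fin 4))).dvd_of_dvd_pow h
    rw [X_dvd_X] at this
    exact absurd this (by decide)

/-- At the point (0, 0, 1, 0) g₁ vanishes and g₃ does not, so the prime g₁ does not divide g₃. -/
theorem g₁_dvd_of_dvd_g₃_mul (z : MvPolynomial (Fin 4) k)
    (h : X 1 ^ 2 - X 0 * X 2 ∣ (X 2 ^ 2 - X 1 * X 3) * z) :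
    (X 1 ^ 2 - X 0 * X 2 : MvPolynomial (Fin 4) k) ∣ z := by
  refine (prime_g₁.dvd_or_dvd h).resolve_left fun h' => ?_
  simpa using map_dvd (eval ![0, 0, 1, 0]) h'

/-- The previous coprimality after setting y = 0. The term `X 1 * 0` is kept so that
`exists_of_minors_syzygy` applies with y replaced by 0. -/
theorem g₁_dvd_of_dvd_X_sq_mul (z : MvPolynomial (Fin 4) k)
    (h : X 1 ^ 2 - X 0 * X 2 ∣ (X 2 ^ 2 - X 1 * 0) * z) :
    (X 1 ^ 2 - X 0 * X 2 : MvPolynomial (Fin 4) k) ∣ z := by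
  refine (prime_g₁.dvd_or_dvd h).resolve_left fun h' => ?_
  simpa using map_dvd (eval ![0, 0, 1, 0]) h'

theorem exists_of_g_syzygy {u v w : MvPolynomial (Fin 4) k}
    (h : u * g₁ k + v * g₂ k + w * g₃ k = 0) :
    ∃ s t, u = X 2 * s - X 3 * t ∧ v = -X 1 * s + X 2 * t ∧ w = X 0 * s - X 1 * t :=
  exists_of_minors_syzygy g₁_ne_zero g₁_dvd_of_dvd_g₃_mul h

/-- `y` is a nonzerodivisor modulo `(g₁, g₂, g₃)`. -/
theorem exists_of_X_mul_eq {z u v w : MvPolynomial (Fin 4) k}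
    (h : X 3 * z = u * g₁ k + v * g₂ k + w * g₃ k) :
    ∃ u' v' w', z = u' * g₁ k + v' * g₂ k + w' * g₃ k := by
  obtain ⟨u₁, hu⟩ := exists_eq_kill_add 3 u
  obtain ⟨v₁, hv⟩ := exists_eq_kill_add 3 v
  obtain ⟨w₁, hw⟩ := exists_eq_kill_add 3 w
  -- At y = 0 the coefficients form a syzygy of the specialised minors, to which Hilbert–Burch still
  -- applies, since g₁ does not involve y.
  have h' := congrArg (kill k 3) h
  simp only [g₁, g₂, g₃, map_mul, map_add, map_sub, map_pow, kill_X_self,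
    kill_X_of_ne (show (0 : Fin 4) ≠ 3 by decide), kill_X_of_ne (show (1 : Fin 4) ≠ 3 by decide),
    kill_X_of_ne (show (2 : Fin 4) ≠ 3 by decide), zero_mul] at h'
  obtain ⟨s, t, hs, ht, hr⟩ := exists_of_minors_syzygy g₁_ne_zero g₁_dvd_of_dvd_X_sq_mul h'.symm
  -- Lifting the specialised syzygy to an honest one replaces 0 * t by y * t in the first entry; the
  -- discrepancy y * t * g₁ is the extra t.
  refine ⟨u₁ + t, v₁, w₁, mul_left_cancel₀ (X_ne_zero (3 : Fin 4)) ?_⟩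
  rw [hs] at hu
  rw [ht] at hv
  rw [hr] at hw
  rw [h, hu, hv, hw, g₁, g₂, g₃]
  ring

theorem exists_of_X_pow_mul_eq (n : ℕ) {z u v w : MvPolynomial (Fin 4) k}
    (h : X 3 ^ n * z = u * g₁ k + v * g₂ k + w * g₃ k) :
    ∃ u' v' w', z = u' * g₁ k + v' * g₂ k + w' * g₃ k := by
  induction n generalizing u v w with
  | zero => exact ⟨u, v, w, by simpa using h⟩
  | succ n ih =>
    obtain ⟨u', v', w', h'⟩ := exists_of_X_mul_eq (z := X 3 ^ n * z) (by rw [← h]; ring)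
    exact ih h'

theorem exists_of_X_syzygy₂ {i j : Fin 4} (hij : i ≠ j) {p q : MvPolynomial (Fin 4) k}
    (h : X i * p + X j * q = 0) : ∃ r, p = X j * r ∧ q = -X i * r := by
  have : (X j : MvPolynomial (Fin 4) k) ∣ X i * p := ⟨-q, by linear_combination h⟩
  obtain ⟨r, hr⟩ := (X_prime.dvd_or_dvd this).resolve_left
    (by rw [X_dvd_X]; exact fun h' => hij h'.symm)
  refine ⟨r, hr, mul_left_cancel₀ (X_ne_zero j) ?_⟩
  rw [hr] at h
  linear_combination h

/-- Exactness of the Koszul complex on x₁, x₂, y: reduce modulo y to the case of two variables, then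
cancel y to find the third entry. -/
theorem exists_of_X_syzygy₃ {p q r : MvPolynomial (Fin 4) k}
    (h : X 1 * p + X 2 * q + X 3 * r = 0) :
    ∃ s t u, p = X 2 * s + X 3 * t ∧ q = -X 1 * s + X 3 * u ∧ r = -X 1 * t - X 2 * u := by
  obtain ⟨p₁, hp⟩ := exists_eq_kill_add 3 p
  obtain ⟨q₁, hq⟩ := exists_eq_kill_add 3 q
  have h' := congrArg (kill k 3) h
  simp only [map_mul, map_add, map_zero, kill_X_self,
    kill_X_of_ne (show (1 : Fin 4) ≠ 3 by decide),
    kill_X_of_ne (show (2 : Fin 4) ≠ 3 by decide), zero_mul, add_zero] at h'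
  obtain ⟨s, hs, hs'⟩ := exists_of_X_syzygy₂ (by decide) h'
  rw [hs] at hp
  rw [hs'] at hq
  refine ⟨s, p₁, q₁, hp, hq, mul_left_cancel₀ (X_ne_zero (3 : Fin 4)) ?_⟩
  rw [hp, hq] at h
  linear_combination h

/-- The coefficient matrix has determinant g₃; multiply by its adjugate. It is the upper 2 × 2 block
of the Hilbert–Burch columns, so it fixes their coordinates in `φ₂`. -/
theorem eq_zero_of_g₃_mul {p q : MvPolynomial (Fin 4) k} (h₁ : X 2 * p - X 3 * q = 0)
    (h₂ : -X 1 * p + X 2 * q = 0) : p = 0 ∧ q = 0 := by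
  constructor
  · refine mul_left_cancel₀ (g₃_ne_zero (k := k)) ?_
    linear_combination X 2 * h₁ + X 3 * h₂
  · refine mul_left_cancel₀ (g₃_ne_zero (k := k)) ?_
    linear_combination X 1 * h₁ + X 2 * h₂

/-! ### Exactness of the three complexes -/

theorem phi₁One_apply (a : ℕ) (z : Fin 6 → MvPolynomial (Fin 4) k) :
    (phi₁One k a).mulVecLin z = ![z 0 * g₁ k + z 1 * g₂ k + z 2 * g₃ k +
      X 3 ^ a * (X 1 * z 3 + X 2 * z 4 + X 3 * z 5)] := by
  ext1 i
  fin_cases i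
  simp [phi₁One, Matrix.mulVec, dotProduct, Fin.sum_univ_succ]
  ring

theorem phi₂One_apply (a : ℕ) (p : Fin 8 → MvPolynomial (Fin 4) k) :
    (phi₂One k a).mulVecLin p =
      ![X 2 * p 0 + X 3 ^ a * p 1 - X 3 * p 2,
        -X 1 * p 0 + X 2 * p 2 + X 3 ^ a * p 3,
        X 0 * p 0 - X 1 * p 2 + X 3 ^ a * p 4,
        -X 1 * p 1 - X 2 * p 3 + X 2 * p 5 + X 3 * p 6,
        X 0 * p 1 - X 2 * p 4 - X 1 * p 5 + X 3 * p 7,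
        X 0 * p 3 + X 1 * p 4 - X 1 * p 6 - X 2 * p 7] := by
  ext1 i
  fin_cases i <;> simp [phi₂One, Matrix.mulVec, dotProduct, Fin.sum_univ_succ] <;> ring

theorem phi₃One_apply (a : ℕ) (q : Fin 3 → MvPolynomial (Fin 4) k) :
    (phi₃One k a).mulVecLin q =
      ![X 3 ^ a * q 0, -X 2 * q 0 + X 3 * q 1, X 3 ^ a * q 1, X 1 * q 0 - X 2 * q 1,
        -X 0 * q 0 + X 1 * q 1, -X 2 * q 1 + X 3 * q 2, X 1 * q 1 - X 2 * q 2,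
        -X 0 * q 1 + X 1 * q 2] := by
  ext1 i
  fin_cases i <;> simp [phi₃One, Matrix.mulVec, dotProduct, Fin.sum_univ_succ] <;> ring

theorem phi₁Two_apply (a : ℕ) (z : Fin 5 → MvPolynomial (Fin 4) k) :
    (phi₁Two k a).mulVecLin z = ![z 0 * g₁ k + z 1 * g₂ k + z 2 * g₃ k +
      X 3 ^ a * (X 2 * z 3 + X 3 * z 4)] := by
  ext1 i
  fin_cases i
  simp [phi₁Two, Matrix.mulVec, dotProduct, Fin.sum_univ_succ]
  ring

theorem phi₂Two_apply (a : ℕ) (p : Fin 5 → MvPolynomial (Fin 4) k) :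
    (phi₂Two k a).mulVecLin p =
      ![X 2 * p 0 - X 3 * p 1,
        -X 1 * p 0 + X 2 * p 1 + X 3 ^ a * p 2,
        X 0 * p 0 - X 1 * p 1 + X 3 ^ a * p 3,
        -X 1 * p 2 - X 2 * p 3 + X 3 * p 4,
        X 0 * p 2 + X 1 * p 3 - X 2 * p 4] := by
  ext1 i
  fin_cases i <;> simp [phi₂Two, Matrix.mulVec, dotProduct, Fin.sum_univ_succ] <;> ring

theorem phi₃Two_apply (a : ℕ) (q : Fin 1 → MvPolynomial (Fin 4) k) :
    (phi₃Two k a).mulVecLin q =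
      ![X 3 ^ (a + 1) * q 0, X 2 * X 3 ^ a * q 0, -g₃ k * q 0, g₂ k * q 0, g₁ k * q 0] := by
  ext1 i
  fin_cases i <;> simp [phi₃Two, Matrix.mulVec, dotProduct]

theorem phi₁Three_apply (a : ℕ) (z : Fin 4 → MvPolynomial (Fin 4) k) :
    (phi₁Three k a).mulVecLin z = ![z 0 * g₁ k + z 1 * g₂ k + z 2 * g₃ k +
      X 3 ^ (a + 1) * z 3] := by
  ext1 i
  fin_cases i
  simp [phi₁Three, Matrix.mulVec, dotProduct, Fin.sum_univ_succ]
  ring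

theorem phi₂Three_apply (a : ℕ) (p : Fin 5 → MvPolynomial (Fin 4) k) :
    (phi₂Three k a).mulVecLin p =
      ![X 2 * p 0 + X 3 ^ (a + 1) * p 1 - X 3 * p 2,
        -X 1 * p 0 + X 2 * p 2 + X 3 ^ (a + 1) * p 3,
        X 0 * p 0 - X 1 * p 2 + X 3 ^ (a + 1) * p 4,
        -(p 1 * g₁ k + p 3 * g₂ k + p 4 * g₃ k)] := by
  ext1 i
  fin_cases i <;> simp [phi₂Three, Matrix.mulVec, dotProduct, Fin.sum_univ_succ] <;> ring

theorem phi₃Three_apply (a : ℕ) (q : Fin 2 → MvPolynomial (Fin 4) k) :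
    (phi₃Three k a).mulVecLin q =
      ![X 3 ^ (a + 1) * q 0, -X 2 * q 0 + X 3 * q 1, X 3 ^ (a + 1) * q 1, X 1 * q 0 - X 2 * q 1,
        -X 0 * q 0 + X 1 * q 1] := by
  ext1 i
  fin_cases i <;> simp [phi₃Three, Matrix.mulVec, dotProduct, Fin.sum_univ_succ]
  ring

theorem exact_phi₂One_phi₁One (a : ℕ) :
    Function.Exact (phi₂One k a).mulVecLin (phi₁One k a).mulVecLin := by
  intro z
  constructor
  · intro h
    rw [phi₁One_apply] at h
    replace h := congrFun h 0
    simp only [Matrix.cons_val, Pi.zero_apply] at h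
    -- Cancelling yᵃ modulo the minors puts x₁ z₃ + x₂ z₄ + y z₅ in (g₁, g₂, g₃). Distributing the
    -- terms of the gᵢ over x₁, x₂, y turns this into a Koszul syzygy, and substituting back leaves
    -- a pure syzygy of the minors.
    obtain ⟨α, β, γ, h₁⟩ := exists_of_X_pow_mul_eq (n := a) (z := X 1 * z 3 + X 2 * z 4 + X 3 * z 5)
      (u := -z 0) (v := -z 1) (w := -z 2) (by linear_combination h)
    obtain ⟨s, t, u, hs, ht, hu⟩ := exists_of_X_syzygy₃ (p := z 3 - α * X 1 - β * X 2)
      (q := z 4 + α * X 0 - γ * X 2) (r := z 5 + β * X 0 + γ * X 1) (by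
        simp only [g₁, g₂, g₃] at h₁
        linear_combination h₁)
    obtain ⟨S, T, h₂, h₃, h₄⟩ := exists_of_g_syzygy (u := z 0 + X 3 ^ a * α)
      (v := z 1 + X 3 ^ a * β) (w := z 2 + X 3 ^ a * γ) (by linear_combination h - X 3 ^ a * h₁)
    refine ⟨![S, -α, T, -β, -γ, s, t, u], ?_⟩
    rw [phi₂One_apply]
    ext1 i
    fin_cases i <;> simp only [Matrix.cons_val, Fin.reduceFinMk, Fin.zero_eta, Fin.mk_one]
    · linear_combination -h₂
    · linear_combination -h₃
    · linear_combination -h₄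
    · linear_combination -hs
    · linear_combination -ht
    · linear_combination -hu
  · rintro ⟨p, rfl⟩
    rw [phi₁One_apply, phi₂One_apply]
    ext1 i
    fin_cases i
    simp only [Matrix.cons_val, Fin.zero_eta, g₁, g₂, g₃, Pi.zero_apply]
    ring

theorem exact_phi₃One_phi₂One (a : ℕ) :
    Function.Exact (phi₃One k a).mulVecLin (phi₂One k a).mulVecLin := by
  intro p
  constructor
  · intro h
    rw [phi₂One_apply] at h
    have e₀ := congrFun h 0
    have e₁ := congrFun h 1
    have e₃ := congrFun h 3
    have e₄ := congrFun h 4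
    have e₅ := congrFun h 5
    simp only [Matrix.cons_val, Pi.zero_apply] at e₀ e₁ e₃ e₄ e₅
    -- Pairing the last three rows with (x₁, x₂, y) kills the Koszul columns and leaves a syzygy of
    -- the minors with coefficients p₁, p₃, p₄.
    obtain ⟨s, t, h₁, h₃, h₄⟩ := exists_of_g_syzygy (u := p 1) (v := p 3) (w := p 4) (by
      simp only [g₁, g₂, g₃]
      linear_combination -X 1 * e₃ - X 2 * e₄ - X 3 * e₅)
    rw [h₁, h₃] at e₃
    rw [h₃, h₄] at e₅
    rw [h₁] at e₀
    rw [h₃] at e₁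
    obtain ⟨r, h₅, h₆⟩ := exists_of_X_syzygy₂ (i := 2) (j := 3) (by decide) (p := p 5 - X 2 * t)
      (q := p 6 + X 1 * t) (by linear_combination e₃)
    have h₇ : p 7 = X 0 * t + X 1 * r := by
      refine mul_left_cancel₀ (X_ne_zero (2 : Fin 4)) ?_
      linear_combination -e₅ - X 1 * h₆
    -- After subtracting the candidate preimage, the first two rows become a homogeneous system of
    -- determinant g₃. The third row is not needed.
    obtain ⟨h₀, h₂⟩ := eq_zero_of_g₃_mul (p := p 0 + X 3 ^ a * s) (q := p 2 + X 3 ^ a * t)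
      (by linear_combination e₀) (by linear_combination e₁)
    refine ⟨![-s, -t, r], ?_⟩
    rw [phi₃One_apply]
    ext1 i
    fin_cases i <;> simp only [Matrix.cons_val, Fin.reduceFinMk, Fin.zero_eta, Fin.mk_one]
    · linear_combination -h₀
    · linear_combination -h₁
    · linear_combination -h₂
    · linear_combination -h₃
    · linear_combination -h₄
    · linear_combination -h₅
    · linear_combination -h₆
    · linear_combination -h₇
  · rintro ⟨p, rfl⟩
    rw [phi₂One_apply, phi₃One_apply]
    ext1 i
    fin_cases i <;> simp only [Matrix.cons_val, Fin.reduceFinMk, Fin.zero_eta, Fin.mk_one,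
      Pi.zero_apply] <;> ring

theorem injective_phi₃One (a : ℕ) : Function.Injective (phi₃One k a).mulVecLin := by
  rw [injective_iff_map_eq_zero]
  intro q h
  rw [phi₃One_apply] at h
  have e₀ := congrFun h 0
  have e₂ := congrFun h 2
  have e₅ := congrFun h 5
  simp only [Matrix.cons_val, Pi.zero_apply] at e₀ e₂ e₅
  have hX : (X 3 : MvPolynomial (Fin 4) k) ≠ 0 := X_ne_zero _
  have h₀ := (mul_eq_zero.mp e₀).resolve_left (pow_ne_zero _ hX)
  have h₁ := (mul_eq_zero.mp e₂).resolve_left (pow_ne_zero _ hX)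
  rw [h₁, mul_zero, zero_add] at e₅
  have h₂ := (mul_eq_zero.mp e₅).resolve_left hX
  ext1 i
  fin_cases i
  exacts [h₀, h₁, h₂]

/-- Only x₂ yᵃ and yᵃ⁺¹ are available here, while g₁ contains x₁². The Koszul relations force its
coefficient α into (x₂, y), and then x₂ g₁ = x₁ g₂ - x₀ g₃ and y g₁ = x₂ g₂ - x₁ g₃ absorb α g₁ into
the terms in g₂ and g₃. -/
theorem exact_phi₂Two_phi₁Two (a : ℕ) :
    Function.Exact (phi₂Two k a).mulVecLin (phi₁Two k a).mulVecLin := by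
  intro z
  constructor
  · intro h
    rw [phi₁Two_apply] at h
    replace h := congrFun h 0
    simp only [Matrix.cons_val, Pi.zero_apply] at h
    obtain ⟨α, β, γ, h₁⟩ := exists_of_X_pow_mul_eq (n := a) (z := X 2 * z 3 + X 3 * z 4)
      (u := -z 0) (v := -z 1) (w := -z 2) (by linear_combination h)
    obtain ⟨s, t, u, hs, ht, hu⟩ := exists_of_X_syzygy₃ (p := -(α * X 1))
      (q := z 3 + α * X 0 - β * X 1 - γ * X 2) (r := z 4 + β * X 0 + γ * X 1) (by
        simp only [g₁, g₂, g₃] at h₁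
        linear_combination h₁)
    -- The first Koszul output is itself a relation x₁ α + x₂ s + y t = 0, so α = x₂ s' + y t'. The
    -- corrections to β and γ below are those produced by rewriting α g₁.
    obtain ⟨s', t', u', hs', ht', hu'⟩ := exists_of_X_syzygy₃ (p := α) (q := s) (r := t)
      (by linear_combination -hs)
    obtain ⟨S, T, h₂, h₃, h₄⟩ := exists_of_g_syzygy (u := z 0)
      (v := z 1 + X 3 ^ a * (β + s' * X 1 + t' * X 2))
      (w := z 2 + X 3 ^ a * (γ - s' * X 0 - t' * X 1)) (by
        rw [hs'] at h₁
        simp only [g₁, g₂, g₃] at h₁ h ⊢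
        linear_combination h - X 3 ^ a * h₁)
    refine ⟨![S, T, -(β + s' * X 1 + t' * X 2), -(γ - s' * X 0 - t' * X 1),
      u - t' * X 0 - X 1 * u'], ?_⟩
    rw [phi₂Two_apply]
    ext1 i
    fin_cases i <;> simp only [Matrix.cons_val, Fin.reduceFinMk, Fin.zero_eta, Fin.mk_one]
    · linear_combination -h₂
    · linear_combination -h₃
    · linear_combination -h₄
    · rw [hs', ht'] at ht
      linear_combination -ht
    · rw [hu'] at hu
      linear_combination -hu
  · rintro ⟨p, rfl⟩
    rw [phi₁Two_apply, phi₂Two_apply]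
    ext1 i
    fin_cases i
    simp only [Matrix.cons_val, Fin.zero_eta, g₁, g₂, g₃, Pi.zero_apply]
    ring

theorem exact_phi₃Two_phi₂Two (a : ℕ) :
    Function.Exact (phi₃Two k a).mulVecLin (phi₂Two k a).mulVecLin := by
  intro p
  constructor
  · intro h
    rw [phi₂Two_apply] at h
    have e₀ := congrFun h 0
    have e₁ := congrFun h 1
    have e₃ := congrFun h 3
    have e₄ := congrFun h 4
    simp only [Matrix.cons_val, Pi.zero_apply] at e₀ e₁ e₃ e₄
    -- The last two rows form a 2 × 3 system in p₂, p₃, p₄. Eliminating p₃ gives g₃ p₄ = -g₁ p₂, and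
    -- coprimality makes the solution a multiple c of the vector of minors.
    obtain ⟨c, hc⟩ := g₁_dvd_of_dvd_g₃_mul (p 4) ⟨-p 2, by
      linear_combination -X 1 * e₃ - X 2 * e₄⟩
    have h₂ : p 2 = -(X 2 ^ 2 - X 1 * X 3) * c := by
      refine mul_left_cancel₀ (g₁_ne_zero (k := k)) ?_
      linear_combination -X 1 * e₃ - X 2 * e₄ - (X 2 ^ 2 - X 1 * X 3) * hc
    have h₃ : p 3 = (X 1 * X 2 - X 0 * X 3) * c := by
      refine mul_left_cancel₀ (g₁_ne_zero (k := k)) ?_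
      linear_combination X 0 * e₃ + X 1 * e₄ + (X 1 * X 2 - X 0 * X 3) * hc
    rw [h₂] at e₁
    obtain ⟨h₀, h₁⟩ := eq_zero_of_g₃_mul (p := p 0 - X 3 ^ (a + 1) * c)
      (q := p 1 - X 2 * X 3 ^ a * c)
      (by linear_combination e₀) (by linear_combination e₁)
    refine ⟨![c], ?_⟩
    rw [phi₃Two_apply]
    ext1 i
    fin_cases i <;> simp only [Matrix.cons_val, Fin.reduceFinMk, Fin.zero_eta, Fin.mk_one,
      g₁, g₂, g₃]
    · linear_combination -h₀
    · linear_combination -h₁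
    · linear_combination -h₂
    · linear_combination -h₃
    · linear_combination -hc
  · rintro ⟨p, rfl⟩
    rw [phi₂Two_apply, phi₃Two_apply]
    ext1 i
    fin_cases i <;> simp only [Matrix.cons_val, Fin.reduceFinMk, Fin.zero_eta, Fin.mk_one,
      Pi.zero_apply, g₁, g₂, g₃] <;> ring

theorem injective_phi₃Two (a : ℕ) : Function.Injective (phi₃Two k a).mulVecLin := by
  rw [injective_iff_map_eq_zero]
  intro q h
  rw [phi₃Two_apply] at h
  have e₀ := congrFun h 0
  simp only [Matrix.cons_val, Pi.zero_apply] at e₀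
  have h₀ := (mul_eq_zero.mp e₀).resolve_left (pow_ne_zero _ (X_ne_zero _))
  ext1 i
  fin_cases i
  exact h₀

theorem exact_phi₂Three_phi₁Three (a : ℕ) :
    Function.Exact (phi₂Three k a).mulVecLin (phi₁Three k a).mulVecLin := by
  intro z
  constructor
  · intro h
    rw [phi₁Three_apply] at h
    replace h := congrFun h 0
    simp only [Matrix.cons_val, Pi.zero_apply] at h
    obtain ⟨α, β, γ, h₁⟩ := exists_of_X_pow_mul_eq (n := a + 1) (z := z 3)
      (u := -z 0) (v := -z 1) (w := -z 2) (by linear_combination h)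
    obtain ⟨S, T, h₂, h₃, h₄⟩ := exists_of_g_syzygy (u := z 0 + X 3 ^ (a + 1) * α)
      (v := z 1 + X 3 ^ (a + 1) * β) (w := z 2 + X 3 ^ (a + 1) * γ)
      (by linear_combination h - X 3 ^ (a + 1) * h₁)
    refine ⟨![S, -α, T, -β, -γ], ?_⟩
    rw [phi₂Three_apply]
    ext1 i
    fin_cases i <;> simp only [Matrix.cons_val, Fin.reduceFinMk, Fin.zero_eta, Fin.mk_one]
    · linear_combination -h₂
    · linear_combination -h₃
    · linear_combination -h₄
    · linear_combination -h₁
  · rintro ⟨p, rfl⟩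
    rw [phi₁Three_apply, phi₂Three_apply]
    ext1 i
    fin_cases i
    simp only [Matrix.cons_val, Fin.zero_eta, g₁, g₂, g₃, Pi.zero_apply]
    ring

theorem exact_phi₃Three_phi₂Three (a : ℕ) :
    Function.Exact (phi₃Three k a).mulVecLin (phi₂Three k a).mulVecLin := by
  intro p
  constructor
  · intro h
    rw [phi₂Three_apply] at h
    have e₀ := congrFun h 0
    have e₁ := congrFun h 1
    have e₃ := congrFun h 3
    simp only [Matrix.cons_val, Pi.zero_apply] at e₀ e₁ e₃
    -- The last row is, up to sign, a syzygy of the minors.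
    obtain ⟨s, t, h₁, h₃, h₄⟩ := exists_of_g_syzygy (u := p 1) (v := p 3) (w := p 4)
      (by linear_combination -e₃)
    rw [h₁] at e₀
    rw [h₃] at e₁
    obtain ⟨h₀, h₂⟩ := eq_zero_of_g₃_mul (p := p 0 + X 3 ^ (a + 1) * s)
      (q := p 2 + X 3 ^ (a + 1) * t) (by linear_combination e₀) (by linear_combination e₁)
    refine ⟨![-s, -t], ?_⟩
    rw [phi₃Three_apply]
    ext1 i
    fin_cases i <;> simp only [Matrix.cons_val, Fin.reduceFinMk, Fin.zero_eta, Fin.mk_one]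
    · linear_combination -h₀
    · linear_combination -h₁
    · linear_combination -h₂
    · linear_combination -h₃
    · linear_combination -h₄
  · rintro ⟨p, rfl⟩
    rw [phi₂Three_apply, phi₃Three_apply]
    ext1 i
    fin_cases i <;> simp only [Matrix.cons_val, Fin.reduceFinMk, Fin.zero_eta, Fin.mk_one,
      Pi.zero_apply, g₁, g₂, g₃] <;> ring

theorem injective_phi₃Three (a : ℕ) : Function.Injective (phi₃Three k a).mulVecLin := by
  rw [injective_iff_map_eq_zero]
  intro q h
  rw [phi₃Three_apply] at h
  have e₀ := congrFun h 0
  have e₂ := congrFun h 2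
  simp only [Matrix.cons_val, Pi.zero_apply] at e₀ e₂
  have hX : (X 3 : MvPolynomial (Fin 4) k) ≠ 0 := X_ne_zero _
  ext1 i
  fin_cases i
  exacts [(mul_eq_zero.mp e₀).resolve_left (pow_ne_zero _ hX),
    (mul_eq_zero.mp e₂).resolve_left (pow_ne_zero _ hX)]

/-! ### Homogeneity and minimality -/

/-- `f` is homogeneous of degree `c' - c`, and is zero if `c' < c`. -/
def IsHomogeneousShift (f : MvPolynomial (Fin 4) k) (c c' : ℕ) : Prop :=
  ∀ e, coeff e f ≠ 0 → e.degree + c = c'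

theorem IsHomogeneousShift.zero (c c' : ℕ) :
    IsHomogeneousShift (0 : MvPolynomial (Fin 4) k) c c' :=
  fun _ h => absurd (coeff_zero _) h

theorem IsHomogeneousShift.neg {f : MvPolynomial (Fin 4) k} {c c' : ℕ}
    (h : IsHomogeneousShift f c c') : IsHomogeneousShift (-f) c c' :=
  fun e he => h e (by simpa using he)

theorem _root_.MvPolynomial.IsHomogeneous.isHomogeneousShift {f : MvPolynomial (Fin 4) k} {n : ℕ}
    (hf : f.IsHomogeneous n) {c c' : ℕ} (h : n + c = c') : IsHomogeneousShift f c c' := by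
  intro e he
  rw [← h, ← hf he, Finsupp.degree_eq_weight_one]
  rfl

theorem mulVecLin_mem_freeComponent {r r' : ℕ} {s : Fin r → ℕ} {s' : Fin r' → ℕ}
    {φ : Matrix (Fin r) (Fin r') (MvPolynomial (Fin 4) k)}
    (hφ : ∀ i j, IsHomogeneousShift (φ i j) (s i) (s' j)) (n : ℕ)
    (v : Fin r' → MvPolynomial (Fin 4) k) (hv : v ∈ freeComponent k s' n) :
    φ.mulVecLin v ∈ freeComponent k s n := by
  intro i e he
  rw [Matrix.mulVecLin_apply, Matrix.mulVec, dotProduct, coeff_sum] at he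
  obtain ⟨j, -, hj⟩ := Finset.exists_ne_zero_of_sum_ne_zero he
  rw [coeff_mul] at hj
  obtain ⟨p, hp, hne⟩ := Finset.exists_ne_zero_of_sum_ne_zero hj
  have h₁ := hφ i j p.1 (left_ne_zero_of_mul hne)
  have h₂ := hv j p.2 (right_ne_zero_of_mul hne)
  rw [← Finset.HasAntidiagonal.mem_antidiagonal.mp hp, map_add]
  omega

theorem mem_irrelevantIdeal_of_constantCoeff {f : MvPolynomial (Fin 4) k}
    (h : constantCoeff f = 0) : f ∈ irrelevantIdeal k := by
  rw [irrelevantIdeal, ← Set.image_univ, mem_ideal_span_X_image]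
  intro e he
  by_contra! h'
  refine (mem_support_iff.mp he) ?_
  have : e = 0 := by
    ext i
    exact h' i (Set.mem_univ i)
  rw [this]
  exact h

theorem range_mulVecLin_le {r r' : ℕ} {φ : Matrix (Fin r) (Fin r') (MvPolynomial (Fin 4) k)}
    (hφ : ∀ i j, constantCoeff (φ i j) = 0) :
    LinearMap.range φ.mulVecLin ≤ irrelevantIdeal k • ⊤ := by
  rintro _ ⟨v, rfl⟩
  rw [pi_eq_sum_univ' (φ.mulVecLin v)]
  refine Submodule.sum_mem _ fun i _ => Submodule.smul_mem_smul ?_ Submodule.mem_top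
  rw [Matrix.mulVecLin_apply, Matrix.mulVec, dotProduct]
  refine Ideal.sum_mem _ fun j _ => (irrelevantIdeal k).mul_mem_right _ ?_
  exact mem_irrelevantIdeal_of_constantCoeff (hφ i j)

theorem isHomogeneous_g₁ : (g₁ k).IsHomogeneous 2 :=
  ((isHomogeneous_X k 1).pow 2).sub ((isHomogeneous_X k 0).mul (isHomogeneous_X k 2))

theorem isHomogeneous_g₂ : (g₂ k).IsHomogeneous 2 :=
  ((isHomogeneous_X k 1).mul (isHomogeneous_X k 2)).sub
    ((isHomogeneous_X k 0).mul (isHomogeneous_X k 3))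

theorem isHomogeneous_g₃ : (g₃ k).IsHomogeneous 2 :=
  ((isHomogeneous_X k 2).pow 2).sub ((isHomogeneous_X k 1).mul (isHomogeneous_X k 3))

theorem isHomogeneousShift_g₁ {c c' : ℕ} (h : 2 + c = c') : IsHomogeneousShift (g₁ k) c c' :=
  isHomogeneous_g₁.isHomogeneousShift h

theorem isHomogeneousShift_g₂ {c c' : ℕ} (h : 2 + c = c') : IsHomogeneousShift (g₂ k) c c' :=
  isHomogeneous_g₂.isHomogeneousShift h

theorem isHomogeneousShift_g₃ {c c' : ℕ} (h : 2 + c = c') : IsHomogeneousShift (g₃ k) c c' :=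
  isHomogeneous_g₃.isHomogeneousShift h

theorem isHomogeneousShift_X (i : Fin 4) {c c' : ℕ} (h : 1 + c = c') :
    IsHomogeneousShift (X i : MvPolynomial (Fin 4) k) c c' :=
  (isHomogeneous_X k i).isHomogeneousShift h

theorem isHomogeneousShift_X_pow (i : Fin 4) (n : ℕ) {c c' : ℕ} (h : n + c = c') :
    IsHomogeneousShift (X i ^ n : MvPolynomial (Fin 4) k) c c' :=
  (isHomogeneous_X_pow i n).isHomogeneousShift h

theorem isHomogeneousShift_X_mul_X_pow (i j : Fin 4) (n : ℕ) {c c' : ℕ} (h : 1 + n + c = c') :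
    IsHomogeneousShift (X i * X j ^ n : MvPolynomial (Fin 4) k) c c' :=
  ((isHomogeneous_X k i).mul (isHomogeneous_X_pow j n)).isHomogeneousShift h

theorem isHomogeneousShift_phi₁One (a : ℕ) (i : Fin 1) (j : Fin 6) :
    IsHomogeneousShift (phi₁One k a i j) (![0] i) (![2, 2, 2, a + 1, a + 1, a + 1] j) := by
  fin_cases i
  fin_cases j
  exacts [isHomogeneousShift_g₁ rfl, isHomogeneousShift_g₂ rfl, isHomogeneousShift_g₃ rfl,
    isHomogeneousShift_X_mul_X_pow _ _ _ (Nat.add_comm 1 a),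
    isHomogeneousShift_X_mul_X_pow _ _ _ (Nat.add_comm 1 a),
    isHomogeneousShift_X_pow _ _ rfl]

theorem isHomogeneousShift_phi₂One (a : ℕ) (i : Fin 6) (j : Fin 8) :
    IsHomogeneousShift (phi₂One k a i j) (![2, 2, 2, a + 1, a + 1, a + 1] i)
      (![3, a + 2, 3, a + 2, a + 2, a + 2, a + 2, a + 2] j) := by
  fin_cases i <;> fin_cases j <;> first
    | exact .zero _ _
    | exact isHomogeneousShift_X _ (Nat.add_comm 1 _)
    | exact (isHomogeneousShift_X _ (Nat.add_comm 1 _)).neg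
    | exact isHomogeneousShift_X_pow _ _ rfl

theorem isHomogeneousShift_phi₃One (a : ℕ) (i : Fin 8) (j : Fin 3) :
    IsHomogeneousShift (phi₃One k a i j) (![3, a + 2, 3, a + 2, a + 2, a + 2, a + 2, a + 2] i)
      (![a + 3, a + 3, a + 3] j) := by
  fin_cases i <;> fin_cases j <;> first
    | exact .zero _ _
    | exact isHomogeneousShift_X _ (Nat.add_comm 1 _)
    | exact (isHomogeneousShift_X _ (Nat.add_comm 1 _)).neg
    | exact isHomogeneousShift_X_pow _ _ rfl

theorem isHomogeneousShift_phi₁Two (a : ℕ) (i : Fin 1) (j : Fin 5) :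
    IsHomogeneousShift (phi₁Two k a i j) (![0] i) (![2, 2, 2, a + 1, a + 1] j) := by
  fin_cases i
  fin_cases j
  exacts [isHomogeneousShift_g₁ rfl, isHomogeneousShift_g₂ rfl, isHomogeneousShift_g₃ rfl,
    isHomogeneousShift_X_mul_X_pow _ _ _ (Nat.add_comm 1 a),
    isHomogeneousShift_X_pow _ _ rfl]

theorem isHomogeneousShift_phi₂Two (a : ℕ) (i : Fin 5) (j : Fin 5) :
    IsHomogeneousShift (phi₂Two k a i j) (![2, 2, 2, a + 1, a + 1] i)
      (![3, 3, a + 2, a + 2, a + 2] j) := by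
  fin_cases i <;> fin_cases j <;> first
    | exact .zero _ _
    | exact isHomogeneousShift_X _ (Nat.add_comm 1 _)
    | exact (isHomogeneousShift_X _ (Nat.add_comm 1 _)).neg
    | exact isHomogeneousShift_X_pow _ _ rfl

theorem isHomogeneousShift_phi₃Two (a : ℕ) (i : Fin 5) (j : Fin 1) :
    IsHomogeneousShift (phi₃Two k a i j) (![3, 3, a + 2, a + 2, a + 2] i) (![a + 4] j) := by
  fin_cases j
  fin_cases i
  exacts [isHomogeneousShift_X_pow _ _ rfl,
    isHomogeneousShift_X_mul_X_pow _ _ _ (by rw [Nat.add_comm 1 a]; rfl),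
    (isHomogeneousShift_g₃ (Nat.add_comm 2 _)).neg, isHomogeneousShift_g₂ (Nat.add_comm 2 _),
    isHomogeneousShift_g₁ (Nat.add_comm 2 _)]

theorem isHomogeneousShift_phi₁Three (a : ℕ) (i : Fin 1) (j : Fin 4) :
    IsHomogeneousShift (phi₁Three k a i j) (![0] i) (![2, 2, 2, a + 1] j) := by
  fin_cases i
  fin_cases j
  exacts [isHomogeneousShift_g₁ rfl, isHomogeneousShift_g₂ rfl, isHomogeneousShift_g₃ rfl,
    isHomogeneousShift_X_pow _ _ rfl]

theorem isHomogeneousShift_phi₂Three (a : ℕ) (i : Fin 4) (j : Fin 5) :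
    IsHomogeneousShift (phi₂Three k a i j) (![2, 2, 2, a + 1] i)
      (![3, a + 3, 3, a + 3, a + 3] j) := by
  fin_cases i
  pick_goal 4
  · fin_cases j
    exacts [.zero _ _, (isHomogeneousShift_g₁ (Nat.add_comm 2 _)).neg, .zero _ _,
      (isHomogeneousShift_g₂ (Nat.add_comm 2 _)).neg,
      (isHomogeneousShift_g₃ (Nat.add_comm 2 _)).neg]
  all_goals
    fin_cases j <;> first
      | exact .zero _ _
      | exact isHomogeneousShift_X _ (Nat.add_comm 1 _)
      | exact (isHomogeneousShift_X _ (Nat.add_comm 1 _)).neg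
      | exact isHomogeneousShift_X_pow _ _ rfl

theorem isHomogeneousShift_phi₃Three (a : ℕ) (i : Fin 5) (j : Fin 2) :
    IsHomogeneousShift (phi₃Three k a i j) (![3, a + 3, 3, a + 3, a + 3] i)
      (![a + 4, a + 4] j) := by
  fin_cases i <;> fin_cases j <;> first
    | exact .zero _ _
    | exact isHomogeneousShift_X _ (Nat.add_comm 1 _)
    | exact (isHomogeneousShift_X _ (Nat.add_comm 1 _)).neg
    | exact isHomogeneousShift_X_pow _ _ rfl

theorem constantCoeff_phi₁One (a : ℕ) (i : Fin 1) (j : Fin 6) :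
    constantCoeff (phi₁One k a i j) = 0 := by
  fin_cases i
  fin_cases j <;> simp [phi₁One, g₁, g₂, g₃]

/-- Positivity of a enters the minimality: for a = 0 the entries yᵃ would be units. -/
theorem constantCoeff_phi₂One {a : ℕ} (ha : a ≠ 0) (i : Fin 6) (j : Fin 8) :
    constantCoeff (phi₂One k a i j) = 0 := by
  fin_cases i <;> fin_cases j <;> simp [phi₂One, ha]

theorem constantCoeff_phi₃One {a : ℕ} (ha : a ≠ 0) (i : Fin 8) (j : Fin 3) :
    constantCoeff (phi₃One k a i j) = 0 := by
  fin_cases i <;> fin_cases j <;> simp [phi₃One, ha]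

theorem constantCoeff_phi₁Two (a : ℕ) (i : Fin 1) (j : Fin 5) :
    constantCoeff (phi₁Two k a i j) = 0 := by
  fin_cases i
  fin_cases j <;> simp [phi₁Two, g₁, g₂, g₃]

theorem constantCoeff_phi₂Two {a : ℕ} (ha : a ≠ 0) (i : Fin 5) (j : Fin 5) :
    constantCoeff (phi₂Two k a i j) = 0 := by
  fin_cases i <;> fin_cases j <;> simp [phi₂Two, ha]

theorem constantCoeff_phi₃Two (a : ℕ) (i : Fin 5) (j : Fin 1) :
    constantCoeff (phi₃Two k a i j) = 0 := by
  fin_cases i <;> fin_cases j <;> simp [phi₃Two, g₁, g₂, g₃]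

theorem constantCoeff_phi₁Three (a : ℕ) (i : Fin 1) (j : Fin 4) :
    constantCoeff (phi₁Three k a i j) = 0 := by
  fin_cases i
  fin_cases j <;> simp [phi₁Three, g₁, g₂, g₃]

theorem constantCoeff_phi₂Three (a : ℕ) (i : Fin 4) (j : Fin 5) :
    constantCoeff (phi₂Three k a i j) = 0 := by
  fin_cases i <;> fin_cases j <;> simp [phi₂Three, g₁, g₂, g₃]

theorem constantCoeff_phi₃Three (a : ℕ) (i : Fin 5) (j : Fin 2) :
    constantCoeff (phi₃Three k a i j) = 0 := by
  fin_cases i <;> fin_cases j <;> simp [phi₃Three]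

/-! ### Normal forms modulo the relation ideal -/

/-- The monomial `x₀ⁱ xᵣ yʲ` of degree `n` and weight `w = 3 j + r`, `r < 3`, where `xᵢ` has
weight `i` and `y` has weight `3`. -/
noncomputable def normalMonomial (k : Type*) [Field k] (n w : ℕ) : MvPolynomial (Fin 4) k :=
  X 0 ^ (n - (w + 2) / 3) * (if w % 3 = 0 then 1 else if w % 3 = 1 then X 1 else X 2) *
    X 3 ^ (w / 3)

theorem normalMonomial_mul_three (n q : ℕ) :
    normalMonomial k n (3 * q) = X 0 ^ (n - q) * X 3 ^ q := by
  have h₁ : (3 * q + 2) / 3 = q := by omega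
  have h₂ : 3 * q / 3 = q := by omega
  have h₃ : 3 * q % 3 = 0 := by omega
  rw [normalMonomial, h₁, h₂, h₃, if_pos rfl, mul_one]

theorem normalMonomial_mul_three_add_one (n q : ℕ) :
    normalMonomial k n (3 * q + 1) = X 0 ^ (n - (q + 1)) * X 1 * X 3 ^ q := by
  have h₁ : (3 * q + 1 + 2) / 3 = q + 1 := by omega
  have h₂ : (3 * q + 1) / 3 = q := by omega
  have h₃ : (3 * q + 1) % 3 = 1 := by omega
  rw [normalMonomial, h₁, h₂, h₃, if_neg one_ne_zero, if_pos rfl]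

theorem normalMonomial_mul_three_add_two (n q : ℕ) :
    normalMonomial k n (3 * q + 2) = X 0 ^ (n - (q + 1)) * X 2 * X 3 ^ q := by
  have h₁ : (3 * q + 2 + 2) / 3 = q + 1 := by omega
  have h₂ : (3 * q + 2) / 3 = q := by omega
  have h₃ : (3 * q + 2) % 3 = 2 := by omega
  rw [normalMonomial, h₁, h₂, h₃, if_neg two_ne_zero, if_neg (by decide)]

/-- The ideal generated by `g₁, g₂, g₃` and the monomials `xᵣ yᵃ` with `b ≤ r`. -/
noncomputable def relationIdeal (k : Type*) [Field k] (a b : ℕ) : Ideal (MvPolynomial (Fin 4) k) :=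
  Ideal.span ({g₁ k, g₂ k, g₃ k} ∪ {f | ∃ r : Fin 4, b ≤ (r : ℕ) ∧ f = X r * X 3 ^ a})

variable {a b : ℕ}

theorem g₁_mem_relationIdeal : g₁ k ∈ relationIdeal k a b :=
  Ideal.subset_span (by simp)

theorem g₂_mem_relationIdeal : g₂ k ∈ relationIdeal k a b :=
  Ideal.subset_span (by simp)

theorem g₃_mem_relationIdeal : g₃ k ∈ relationIdeal k a b :=
  Ideal.subset_span (by simp)

theorem X_mul_X_pow_mem_relationIdeal {r : Fin 4} (h : b ≤ (r : ℕ)) :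
    X r * X 3 ^ a ∈ relationIdeal k a b :=
  Ideal.subset_span (Or.inr ⟨r, h, rfl⟩)

/-- Large weight forces either a factor yᵃ⁺¹ or, when w = 3a + r with r < 3, a factor xᵣ yᵃ with r ≥
b. The value w = 3a does not occur because b ≥ 1. -/
theorem normalMonomial_mem_relationIdeal (hb : 1 ≤ b ∧ b ≤ 3) {n w : ℕ} (h : 3 * a + b ≤ w) :
    normalMonomial k n w ∈ relationIdeal k a b := by
  by_cases hq : a + 1 ≤ w / 3
  · rw [normalMonomial, ← Nat.add_sub_of_le hq, pow_add, pow_succ']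
    exact Ideal.mul_mem_left _ _ (Ideal.mul_mem_right _ _ (X_mul_X_pow_mem_relationIdeal hb.2))
  · have : w = 3 * a ∨ w = 3 * a + 1 ∨ w = 3 * a + 2 := by omega
    rcases this with rfl | rfl | rfl
    · omega
    · rw [normalMonomial_mul_three_add_one, mul_assoc]
      exact Ideal.mul_mem_left _ _ (X_mul_X_pow_mem_relationIdeal (by simp; omega))
    · rw [normalMonomial_mul_three_add_two, mul_assoc]
      exact Ideal.mul_mem_left _ _ (X_mul_X_pow_mem_relationIdeal (by simp; omega))

/-- Degree goes up by 1 and weight by i. Only four products need rewriting: x₁ x₁ by g₁, x₁ x₂ and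
x₂ x₁ by g₂, x₂ x₂ by g₃. The bound on w keeps the truncated exponent of x₀ correct. -/
theorem X_mul_normalMonomial_sub_mem (i : Fin 4) {n w : ℕ} (h : w ≤ 3 * n) :
    X i * normalMonomial k n w - normalMonomial k (n + 1) (w + i) ∈ relationIdeal k a b := by
  have key : ∀ f c g h : MvPolynomial (Fin 4) k, g ∈ relationIdeal k a b → f - h = c * g →
      f - h ∈ relationIdeal k a b := by
    intro f c g h hg e
    rw [e]
    exact Ideal.mul_mem_left _ _ hg
  have hw : ∃ q, w = 3 * q ∨ w = 3 * q + 1 ∨ w = 3 * q + 2 := ⟨w / 3, by omega⟩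
  obtain ⟨q, rfl | rfl | rfl⟩ := hw
  · obtain ⟨r, rfl⟩ : ∃ r, n = q + r := ⟨n - q, by omega⟩
    have h₁ : q + r - q = r := by omega
    have h₂ : q + r + 1 - q = r + 1 := by omega
    have h₃ : q + r + 1 - (q + 1) = r := by omega
    fin_cases i
    · refine key _ 0 _ _ g₁_mem_relationIdeal ?_
      change X 0 * _ - normalMonomial k _ (3 * q) = _
      rw [normalMonomial_mul_three, normalMonomial_mul_three, h₁, h₂]
      ring
    · refine key _ 0 _ _ g₁_mem_relationIdeal ?_
      change X 1 * _ - normalMonomial k _ (3 * q + 1) = _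
      rw [normalMonomial_mul_three, normalMonomial_mul_three_add_one, h₁, h₃]
      ring
    · refine key _ 0 _ _ g₁_mem_relationIdeal ?_
      change X 2 * _ - normalMonomial k _ (3 * q + 2) = _
      rw [normalMonomial_mul_three, normalMonomial_mul_three_add_two, h₁, h₃]
      ring
    · refine key _ 0 _ _ g₁_mem_relationIdeal ?_
      change X 3 * _ - normalMonomial k _ (3 * (q + 1)) = _
      rw [normalMonomial_mul_three, normalMonomial_mul_three, h₁, h₃]
      ring
  · obtain ⟨r, rfl⟩ : ∃ r, n = q + 1 + r := ⟨n - (q + 1), by omega⟩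
    have h₁ : q + 1 + r - (q + 1) = r := by omega
    have h₂ : q + 1 + r + 1 - (q + 1) = r + 1 := by omega
    have h₃ : q + 1 + r + 1 - (q + 1 + 1) = r := by omega
    fin_cases i
    · refine key _ 0 _ _ g₁_mem_relationIdeal ?_
      change X 0 * _ - normalMonomial k _ (3 * q + 1) = _
      rw [normalMonomial_mul_three_add_one, normalMonomial_mul_three_add_one, h₁, h₂]
      ring
    · refine key _ (X 0 ^ r * X 3 ^ q) _ _ g₁_mem_relationIdeal ?_
      change X 1 * _ - normalMonomial k _ (3 * q + 2) = _
      rw [normalMonomial_mul_three_add_one, normalMonomial_mul_three_add_two, h₁, h₂, g₁]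
      ring
    · refine key _ (X 0 ^ r * X 3 ^ q) _ _ g₂_mem_relationIdeal ?_
      change X 2 * _ - normalMonomial k _ (3 * (q + 1)) = _
      rw [normalMonomial_mul_three_add_one, normalMonomial_mul_three, h₁, h₂, g₂]
      ring
    · refine key _ 0 _ _ g₁_mem_relationIdeal ?_
      change X 3 * _ - normalMonomial k _ (3 * (q + 1) + 1) = _
      rw [normalMonomial_mul_three_add_one, normalMonomial_mul_three_add_one, h₁, h₃]
      ring
  · obtain ⟨r, rfl⟩ : ∃ r, n = q + 1 + r := ⟨n - (q + 1), by omega⟩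
    have h₁ : q + 1 + r - (q + 1) = r := by omega
    have h₂ : q + 1 + r + 1 - (q + 1) = r + 1 := by omega
    have h₃ : q + 1 + r + 1 - (q + 1 + 1) = r := by omega
    fin_cases i
    · refine key _ 0 _ _ g₁_mem_relationIdeal ?_
      change X 0 * _ - normalMonomial k _ (3 * q + 2) = _
      rw [normalMonomial_mul_three_add_two, normalMonomial_mul_three_add_two, h₁, h₂]
      ring
    · refine key _ (X 0 ^ r * X 3 ^ q) _ _ g₂_mem_relationIdeal ?_
      change X 1 * _ - normalMonomial k _ (3 * (q + 1)) = _
      rw [normalMonomial_mul_three_add_two, normalMonomial_mul_three, h₁, h₂, g₂]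
      ring
    · refine key _ (X 0 ^ r * X 3 ^ q) _ _ g₃_mem_relationIdeal ?_
      change X 2 * _ - normalMonomial k _ (3 * (q + 1) + 1) = _
      rw [normalMonomial_mul_three_add_two, normalMonomial_mul_three_add_one, h₁, h₃, g₃]
      ring
    · refine key _ 0 _ _ g₁_mem_relationIdeal ?_
      change X 3 * _ - normalMonomial k _ (3 * (q + 1) + 2) = _
      rw [normalMonomial_mul_three_add_two, normalMonomial_mul_three_add_two, h₁, h₃]
      ring

/-- The weight of a monomial: `xᵢ` has weight `i` and `y` has weight `3`. -/
def weightHom : (Fin 4 →₀ ℕ) →+ ℕ where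
  toFun e := ∑ i, e i * (i : ℕ)
  map_zero' := by simp
  map_add' e e' := by simp [add_mul, Finset.sum_add_distrib]

theorem weightHom_single (i : Fin 4) : weightHom (Finsupp.single i 1) = i := by
  change ∑ j, Finsupp.single i 1 j * (j : ℕ) = i
  rw [Finset.sum_eq_single i]
  · simp
  · intro j _ hj
    simp [Finsupp.single_eq_of_ne hj]
  · simp

theorem weightHom_le (e : Fin 4 →₀ ℕ) : weightHom e ≤ 3 * e.degree := by
  change ∑ i, e i * (i : ℕ) ≤ _
  rw [Finsupp.degree_eq_sum, Finset.mul_sum]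
  refine Finset.sum_le_sum fun i _ => ?_
  rw [mul_comm]
  exact Nat.mul_le_mul_right _ (by omega)

/-- Build the monomial up one variable at a time; each multiplication preserves the normal form
modulo the ideal. -/
theorem monomial_sub_normalMonomial_mem (e : Fin 4 →₀ ℕ) :
    monomial e 1 - normalMonomial k e.degree (weightHom e) ∈ relationIdeal k a b := by
  induction hn : e.degree generalizing e with
  | zero =>
    rw [(Finsupp.degree_eq_zero_iff e).mp hn, map_zero]
    convert Ideal.zero_mem _
    rw [sub_eq_zero]
    simpa using (normalMonomial_mul_three (k := k) 0 0).symm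
  | succ n ih =>
    have he : e ≠ 0 := by
      rintro rfl
      simp at hn
    obtain ⟨i, hi⟩ := Finsupp.ne_iff.mp he
    have hle : Finsupp.single i 1 ≤ e := by
      rw [Finsupp.single_le_iff]
      exact Nat.one_le_iff_ne_zero.mpr hi
    obtain ⟨e', rfl⟩ := exists_add_of_le hle
    rw [map_add, Finsupp.degree_single, add_comm, Nat.succ_inj] at hn
    have h₁ := ih e' hn
    have h₂ := X_mul_normalMonomial_sub_mem (k := k) (a := a) (b := b) i (weightHom_le e')
    rw [hn] at h₂
    have h₃ := Ideal.add_mem _ (Ideal.mul_mem_left _ (X i) h₁) h₂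
    convert h₃ using 1
    rw [map_add, weightHom_single, add_comm (i : ℕ)]
    have : (monomial (Finsupp.single i 1 + e') 1 : MvPolynomial (Fin 4) k) =
        X i * monomial e' 1 := by
      rw [X, monomial_mul, one_mul]
    rw [this]
    ring

/-- A polynomial belongs to the relation ideal if the sums of its coefficients over the monomials
of fixed degree and of fixed weight less than `3 a + b` vanish. -/
theorem mem_relationIdeal_of_sum_eq_zero (hb : 1 ≤ b ∧ b ≤ 3) {p : MvPolynomial (Fin 4) k}
    (h : ∀ n w, w < 3 * a + b →
      ∑ e ∈ p.support with e.degree = n ∧ weightHom e = w, coeff e p = 0) :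
    p ∈ relationIdeal k a b := by
  classical
  -- Write p as its deviation from normal form plus the normal form itself. In the latter, terms of
  -- equal degree and weight coincide, so only the sums in the hypothesis remain, apart from weights
  -- ≥ 3a + b, where the normal monomial is in the ideal.
  have h₁ : ∑ e ∈ p.support, C (coeff e p) *
      (monomial e 1 - normalMonomial k e.degree (weightHom e)) ∈ relationIdeal k a b :=
    Ideal.sum_mem _ fun e _ => Ideal.mul_mem_left _ _ (monomial_sub_normalMonomial_mem e)
  have h₂ : ∑ e ∈ p.support, C (coeff e p) * normalMonomial k e.degree (weightHom e) ∈
      relationIdeal k a b := by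
    rw [← Finset.sum_fiberwise_of_maps_to (g := fun e => (e.degree, weightHom e))
      (fun e he => Finset.mem_image_of_mem _ he)]
    refine Ideal.sum_mem _ ?_
    rintro ⟨n, w⟩ -
    have : ∑ e ∈ p.support with (e.degree, weightHom e) = (n, w),
        C (coeff e p) * normalMonomial k e.degree (weightHom e) =
        C (∑ e ∈ p.support with e.degree = n ∧ weightHom e = w, coeff e p) *
          normalMonomial k n w := by
      rw [map_sum, Finset.sum_mul]
      refine Finset.sum_congr (by simp only [Prod.mk.injEq]) fun e he => ?_
      rw [Finset.mem_filter] at he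
      rw [he.2.1, he.2.2]
    rw [this]
    by_cases hw : w < 3 * a + b
    · rw [h n w hw, map_zero, zero_mul]
      exact Ideal.zero_mem _
    · exact Ideal.mul_mem_left _ _ (normalMonomial_mem_relationIdeal hb (not_lt.mp hw))
  convert Ideal.add_mem _ h₁ h₂ using 1
  rw [← Finset.sum_add_distrib]
  conv_lhs => rw [p.as_sum]
  refine Finset.sum_congr rfl fun e _ => ?_
  rw [mul_sub, sub_add_cancel, C_mul_monomial, mul_one]

/-! ### Orders in the local ring -/

/-- All exponents of `f` are of the form `n * m 0 + w * d` with `j ≤ n`. -/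
def HasOrderGE {m : Fin 4 → ℕ} (d j : ℕ) (f : localRing k m) : Prop :=
  ∀ N, PowerSeries.coeff N (f : PowerSeries k) ≠ 0 → ∃ n w, j ≤ n ∧ N = n * m 0 + w * d

variable {m : Fin 4 → ℕ} {d : ℕ}

theorem hasOrderGE_zero (hm : ∀ i : Fin 4, m i = m 0 + (i : ℕ) * d) (f : localRing k m) :
    HasOrderGE d 0 f := by
  intro N hN
  refine AddSubmonoid.closure_induction (motive := fun N _ => ∃ n w, 0 ≤ n ∧ N = n * m 0 + w * d)
    ?_ ?_ ?_ (f.2 N hN)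
  · rintro _ ⟨i, rfl⟩
    exact ⟨1, i, Nat.zero_le _, by rw [hm i, one_mul]⟩
  · exact ⟨0, 0, le_rfl, by simp⟩
  · rintro _ _ _ _ ⟨n, w, -, rfl⟩ ⟨n', w', -, rfl⟩
    exact ⟨n + n', w + w', Nat.zero_le _, by ring⟩

theorem HasOrderGE.add {j : ℕ} {f g : localRing k m} (hf : HasOrderGE d j f)
    (hg : HasOrderGE d j g) : HasOrderGE d j (f + g) := by
  intro N hN
  by_cases h : PowerSeries.coeff N (f : PowerSeries k) = 0
  · refine hg N fun h' => hN ?_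
    change PowerSeries.coeff N ((f : PowerSeries k) + (g : PowerSeries k)) = 0
    rw [map_add, h, h', add_zero]
  · exact hf N h

theorem HasOrderGE.mul {i j : ℕ} {f g : localRing k m} (hf : HasOrderGE d i f)
    (hg : HasOrderGE d j g) : HasOrderGE d (i + j) (f * g) := by
  intro N hN
  change PowerSeries.coeff N ((f : PowerSeries k) * (g : PowerSeries k)) ≠ 0 at hN
  rw [PowerSeries.coeff_mul] at hN
  obtain ⟨p, hp, hne⟩ := Finset.exists_ne_zero_of_sum_ne_zero hN
  obtain ⟨n, w, hn, h⟩ := hf _ (left_ne_zero_of_mul hne)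
  obtain ⟨n', w', hn', h'⟩ := hg _ (right_ne_zero_of_mul hne)
  refine ⟨n + n', w + w', add_le_add hn hn', ?_⟩
  rw [← Finset.HasAntidiagonal.mem_antidiagonal.mp hp, h, h']
  ring

theorem hasOrderGE_one_of_mem_maxIdeal (hm : ∀ i : Fin 4, m i = m 0 + (i : ℕ) * d)
    {f : localRing k m} (hf : f ∈ maxIdeal k m) : HasOrderGE d 1 f := by
  refine Submodule.span_induction (p := fun f _ => HasOrderGE d 1 f) ?_ ?_ ?_ ?_ hf
  · rintro _ ⟨i, rfl⟩ N hN
    refine ⟨1, i, le_rfl, ?_⟩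
    by_contra h
    refine hN ?_
    change PowerSeries.coeff N (PowerSeries.monomial (m i) (1 : k)) = 0
    rw [PowerSeries.coeff_monomial, if_neg]
    rwa [hm i, ← one_mul (m 0)]
  · intro N hN
    exact absurd (map_zero _) hN
  · intro f g _ _ hf hg
    exact hf.add hg
  · intro c f _ hf
    have := (hasOrderGE_zero hm c).mul hf
    rwa [zero_add] at this

theorem hasOrderGE_of_mem_pow (hm : ∀ i : Fin 4, m i = m 0 + (i : ℕ) * d) {j : ℕ}
    {f : localRing k m} (hf : f ∈ maxIdeal k m ^ j) : HasOrderGE d j f := by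
  induction j generalizing f with
  | zero => exact hasOrderGE_zero hm f
  | succ j ih =>
    rw [pow_succ] at hf
    refine Submodule.mul_induction_on hf ?_ ?_
    · intro u hu v hv
      exact (ih hu).mul (hasOrderGE_one_of_mem_maxIdeal hm hv)
    · intro u v hu hv
      exact hu.add hv

/-- An exponent in 𝔪ⁿ⁺¹ equal to n m₀ + w d would give (w - w') d as a positive multiple of m₀. By
coprimality m₀ divides w - w', which is smaller than m₀, so it is 0, a contradiction. -/
theorem coeff_eq_zero_of_mem_pow_succ (hm : ∀ i : Fin 4, m i = m 0 + (i : ℕ) * d)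
    (hcop : Nat.Coprime (m 0) d) (hd : 0 < d) {n w : ℕ} (hw : w < m 0)
    {f : localRing k m} (hf : f ∈ maxIdeal k m ^ (n + 1)) :
    PowerSeries.coeff (n * m 0 + w * d) (f : PowerSeries k) = 0 := by
  by_contra h
  obtain ⟨n', w', hn, h'⟩ := hasOrderGE_of_mem_pow hm hf _ h
  obtain ⟨q, rfl⟩ := Nat.exists_eq_add_of_le hn
  have h₁ : w * d = w' * d + (q + 1) * m 0 := by
    have : (n + 1 + q) * m 0 = n * m 0 + (q + 1) * m 0 := by ring
    omega
  have hle : w' ≤ w := by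
    refine Nat.le_of_mul_le_mul_right (c := d) ?_ hd
    omega
  obtain ⟨u, rfl⟩ := Nat.exists_eq_add_of_le hle
  have h₂ : u * d = (q + 1) * m 0 := by
    rw [add_mul] at h₁
    omega
  have hdvd : m 0 ∣ u := hcop.dvd_of_dvd_mul_right ⟨q + 1, by rw [h₂, mul_comm]⟩
  have hu : u = 0 := Nat.eq_zero_of_dvd_of_lt hdvd (by omega)
  rw [hu, zero_mul] at h₂
  have : m 0 = 0 := by
    rcases Nat.mul_eq_zero.mp h₂.symm with h | h
    · omega
    · exact h
  omega

theorem exists_add_of_mem_closure {N : ℕ} (hN : N ∈ AddSubmonoid.closure (Set.range m)) :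
    N = 0 ∨ ∃ i, ∃ s ∈ AddSubmonoid.closure (Set.range m), N = m i + s := by
  refine AddSubmonoid.closure_induction
    (motive := fun N _ => N = 0 ∨ ∃ i, ∃ s ∈ AddSubmonoid.closure (Set.range m), N = m i + s)
    ?_ ?_ ?_ hN
  · rintro _ ⟨i, rfl⟩
    exact Or.inr ⟨i, 0, zero_mem _, rfl⟩
  · exact Or.inl rfl
  · rintro x y - hy (rfl | ⟨i, s, hs, rfl⟩) hy'
    · rwa [zero_add]
    · exact Or.inr ⟨i, s + y, add_mem hs hy, by rw [add_assoc]⟩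

/-- A series may have infinitely many terms, so its support is split into four classes: each nonzero
exponent is m i + s with s in the semigroup, and one such i is chosen. The terms of class i sum to
t^(m i) times a series in the ring. -/
theorem mem_maxIdeal_of_coeff_zero {f : localRing k m}
    (hf : PowerSeries.coeff 0 (f : PowerSeries k) = 0) : f ∈ maxIdeal k m := by
  classical
  have hex : ∀ N, ∃ i : Fin 4, PowerSeries.coeff N (f : PowerSeries k) ≠ 0 →
      ∃ s ∈ AddSubmonoid.closure (Set.range m), N = m i + s := by
    intro N
    by_cases h : PowerSeries.coeff N (f : PowerSeries k) = 0
    · exact ⟨0, fun h' => absurd h h'⟩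
    · rcases exists_add_of_mem_closure (f.2 N h) with rfl | ⟨i, hi⟩
      · exact absurd hf h
      · exact ⟨i, fun _ => hi⟩
  choose idx hidx using hex
  let g : Fin 4 → localRing k m := fun i =>
    ⟨PowerSeries.mk fun s => if idx (m i + s) = i then
      PowerSeries.coeff (m i + s) (f : PowerSeries k) else 0, by
        intro s hs
        rw [PowerSeries.coeff_mk] at hs
        split_ifs at hs with h
        · obtain ⟨s', hs', h'⟩ := hidx _ hs
          rw [h] at h'
          rwa [Nat.add_left_cancel h']
        · exact absurd rfl hs⟩
  have hfg : f = ∑ i, tPow k m i * g i := by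
    apply Subtype.ext
    rw [AddSubmonoidClass.coe_finsetSum]
    ext N
    rw [map_sum]
    have hterm : ∀ i, PowerSeries.coeff N ((tPow k m i * g i : localRing k m) : PowerSeries k) =
        if idx N = i then PowerSeries.coeff N (f : PowerSeries k) else 0 := by
      intro i
      have hmul : ((tPow k m i * g i : localRing k m) : PowerSeries k) =
          PowerSeries.monomial (m i) (1 : k) * PowerSeries.mk fun s => if idx (m i + s) = i then
            PowerSeries.coeff (m i + s) (f : PowerSeries k) else 0 := rfl
      rw [hmul, ← PowerSeries.X_pow_eq, PowerSeries.coeff_X_pow_mul']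
      split_ifs with h₁ h₂ h₂
      · rw [PowerSeries.coeff_mk, Nat.add_sub_of_le h₁, if_pos h₂]
      · rw [PowerSeries.coeff_mk, Nat.add_sub_of_le h₁, if_neg h₂]
      -- Here m i > N although i is the index chosen for N; a nonzero coefficient at N would give N
      -- = m i + s.
      · by_contra h
        obtain ⟨s, -, hs⟩ := hidx N (Ne.symm h)
        rw [h₂] at hs
        omega
      · rfl
    simp only [hterm]
    simp
  rw [hfg]
  exact Ideal.sum_mem _ fun i _ => Ideal.mul_mem_right _ _ (Ideal.subset_span ⟨i, rfl⟩)

theorem exists_sub_algebraMap_mem_maxIdeal (f : localRing k m) :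
    ∃ c : k, f - algebraMap k (localRing k m) c ∈ maxIdeal k m := by
  refine ⟨PowerSeries.coeff 0 (f : PowerSeries k), mem_maxIdeal_of_coeff_zero ?_⟩
  change PowerSeries.coeff 0 ((f : PowerSeries k) - PowerSeries.C _) = 0
  rw [map_sub, PowerSeries.coeff_C, if_pos rfl, sub_self]

/-! ### The homomorphism to the associated graded ring -/

theorem tPow_mem_maxIdeal (i : Fin 4) : tPow k m i ∈ maxIdeal k m :=
  Ideal.subset_span ⟨i, rfl⟩

/-- The lift of `k[x₀, x₁, x₂, y] → G` to the Rees algebra. -/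
noncomputable def toRees (k : Type*) [Field k] (m : Fin 4 → ℕ) :
    MvPolynomial (Fin 4) k →ₐ[k] reesAlgebra (maxIdeal k m) :=
  aeval fun i => ⟨Polynomial.monomial 1 (tPow k m i),
    reesAlgebra.monomial_mem.mpr (by rw [pow_one]; exact tPow_mem_maxIdeal i)⟩

theorem toG_eq_mk (p : MvPolynomial (Fin 4) k) :
    toG k m p = Ideal.Quotient.mk _ (toRees k m p) := by
  have : toG k m = (Ideal.Quotient.mkₐ k _).comp (toRees k m) := by
    refine algHom_ext fun i => ?_
    rw [AlgHom.comp_apply, toG, toRees, aeval_X, aeval_X]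
    rfl
  rw [this]
  rfl

theorem coe_toRees_X (i : Fin 4) :
    (toRees k m (X i) : Polynomial (localRing k m)) = Polynomial.monomial 1 (tPow k m i) := by
  rw [toRees, aeval_X]

theorem coe_toRees_monomial (e : Fin 4 →₀ ℕ) (c : k) :
    (toRees k m (monomial e c) : Polynomial (localRing k m)) =
      Polynomial.monomial e.degree (c • ∏ i, tPow k m i ^ e i) := by
  let ι : MvPolynomial (Fin 4) k →+* Polynomial (localRing k m) :=
    (reesAlgebra (maxIdeal k m)).val.toRingHom.comp (toRees k m).toRingHom
  have hC : ι (C c) = Polynomial.C (algebraMap k (localRing k m) c) :=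
    congrArg Subtype.val ((toRees k m).commutes c)
  change ι (monomial e c) = _
  rw [monomial_eq, Finsupp.prod_fintype _ _ fun _ => pow_zero _, map_mul, hC, map_prod,
    ← Polynomial.C_mul_X_pow_eq_monomial, Algebra.smul_def, Polynomial.C_mul, mul_assoc,
    Finsupp.degree_eq_sum, ← Finset.prod_pow_eq_pow_sum, map_prod, ← Finset.prod_mul_distrib]
  congr 1
  refine Finset.prod_congr rfl fun i _ => ?_
  have hX : ι (X i) = Polynomial.monomial 1 (tPow k m i) := coe_toRees_X i
  rw [map_pow, hX, Polynomial.monomial_pow, one_mul, Polynomial.C_mul_X_pow_eq_monomial]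

theorem coe_prod_tPow (e : Fin 4 →₀ ℕ) :
    ((∏ i, tPow k m i ^ e i : localRing k m) : PowerSeries k) =
      PowerSeries.X ^ (∑ i, e i * m i) := by
  rw [← Finset.prod_pow_eq_pow_sum]
  change (localRing k m).val (∏ i, tPow k m i ^ e i) = _
  rw [map_prod]
  refine Finset.prod_congr rfl fun i _ => ?_
  rw [map_pow, mul_comm, pow_mul, PowerSeries.X_pow_eq]
  rfl

theorem sum_mul_eq (hm : ∀ i : Fin 4, m i = m 0 + (i : ℕ) * d) (e : Fin 4 →₀ ℕ) :
    ∑ i, e i * m i = e.degree * m 0 + weightHom e * d := by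
  change _ = _ + (∑ i, e i * (i : ℕ)) * d
  rw [Finsupp.degree_eq_sum, Finset.sum_mul, Finset.sum_mul, ← Finset.sum_add_distrib]
  refine Finset.sum_congr rfl fun i _ => ?_
  rw [hm i]
  ring

/-- A monomial of degree n and weight w is sent to t^(n m₀ + w d) Tⁿ. Once n is fixed, d > 0 lets
the exponent of t determine w. -/
theorem coeff_coeff_toRees (hm : ∀ i : Fin 4, m i = m 0 + (i : ℕ) * d) (hd : 0 < d)
    (p : MvPolynomial (Fin 4) k) (n w : ℕ) :
    PowerSeries.coeff (n * m 0 + w * d)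
      (((toRees k m p : Polynomial (localRing k m)).coeff n : localRing k m) : PowerSeries k) =
      ∑ e ∈ p.support with e.degree = n ∧ weightHom e = w, coeff e p := by
  classical
  conv_lhs => rw [p.as_sum]
  rw [map_sum, AddSubmonoidClass.coe_finsetSum, Polynomial.finsetSum_coeff,
    AddSubmonoidClass.coe_finsetSum, map_sum, Finset.sum_filter]
  refine Finset.sum_congr rfl fun e _ => ?_
  rw [coe_toRees_monomial, Polynomial.coeff_monomial]
  by_cases hn : e.degree = n
  · rw [if_pos hn]
    change PowerSeries.coeff _ (coeff e p • ((∏ i, tPow k m i ^ e i : localRing k m) :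
      PowerSeries k)) = _
    rw [coe_prod_tPow, sum_mul_eq hm, map_smul, PowerSeries.coeff_X_pow, hn, smul_eq_mul]
    simp only [true_and, Nat.add_left_cancel_iff, Nat.mul_left_inj hd.ne', mul_ite, mul_one,
      mul_zero]
    simp only [eq_comm]
  · rw [if_neg hn, if_neg fun h => hn h.1]
    exact map_zero _

theorem coeff_mem_pow_succ_of_mem_map {A : Type*} [CommRing A] {I : Ideal A} {p : reesAlgebra I}
    (hp : p ∈ I.map (algebraMap A (reesAlgebra I))) (n : ℕ) :
    (p : Polynomial A).coeff n ∈ I ^ (n + 1) := by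
  refine Submodule.span_induction (R := reesAlgebra I)
    (p := fun (q : reesAlgebra I) _ => ∀ n, (q : Polynomial A).coeff n ∈ I ^ (n + 1))
    ?_ ?_ ?_ ?_ hp n
  · rintro _ ⟨c, hc, rfl⟩ n
    change (Polynomial.C c).coeff n ∈ _
    rw [Polynomial.coeff_C]
    split_ifs with h
    · subst h
      simpa using hc
    · exact Ideal.zero_mem _
  · simp
  · intro x y _ _ hx hy n
    simpa using Ideal.add_mem _ (hx n) (hy n)
  · intro r x _ hx n
    change ((r : Polynomial A) * (x : Polynomial A)).coeff n ∈ _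
    rw [Polynomial.coeff_mul]
    refine Ideal.sum_mem _ fun q hq => ?_
    rw [← Finset.HasAntidiagonal.mem_antidiagonal.mp hq, add_assoc, pow_add]
    exact Ideal.mul_mem_mul (r.2 q.1) (hx q.2)

theorem mem_relationIdeal_of_toG_eq_zero {a b : ℕ} (hb : 1 ≤ b ∧ b ≤ 3) (hd : 0 < d)
    (hm₀ : m 0 = 3 * a + b) (hm : ∀ i : Fin 4, m i = m 0 + (i : ℕ) * d)
    (hcop : Nat.Coprime (m 0) d) {p : MvPolynomial (Fin 4) k} (hp : toG k m p = 0) :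
    p ∈ relationIdeal k a b := by
  rw [toG_eq_mk, Ideal.Quotient.eq_zero_iff_mem] at hp
  refine mem_relationIdeal_of_sum_eq_zero hb fun n w hw => ?_
  rw [← coeff_coeff_toRees hm hd]
  exact coeff_eq_zero_of_mem_pow_succ hm hcop hd (hm₀ ▸ hw) (coeff_mem_pow_succ_of_mem_map hp n)

theorem toG_eq_cls {p : MvPolynomial (Fin 4) k} {n : ℕ} {f : localRing k m}
    (hf : f ∈ maxIdeal k m ^ n)
    (h : (toRees k m p : Polynomial (localRing k m)) = Polynomial.monomial n f) :
    toG k m p = AssociatedGraded.cls (maxIdeal k m) n ⟨f, hf⟩ := by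
  rw [toG_eq_mk]
  exact congrArg _ (Subtype.ext h)

theorem toG_eq_zero {p : MvPolynomial (Fin 4) k} {n : ℕ} {f : localRing k m}
    (hf : f ∈ maxIdeal k m ^ (n + 1))
    (h : (toRees k m p : Polynomial (localRing k m)) = Polynomial.monomial n f) :
    toG k m p = 0 := by
  rw [toG_eq_cls (Ideal.pow_le_pow_right n.le_succ hf) h, AssociatedGraded.cls_eq_zero_iff]
  exact hf

theorem tPow_mul_tPow_eq {i j i' j' : Fin 4} (h : m i + m j = m i' + m j') :
    tPow k m i * tPow k m j = tPow k m i' * tPow k m j' := by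
  apply Subtype.ext
  change PowerSeries.monomial (m i) (1 : k) * PowerSeries.monomial (m j) 1 =
    PowerSeries.monomial (m i') 1 * PowerSeries.monomial (m j') 1
  rw [PowerSeries.monomial_mul_monomial, PowerSeries.monomial_mul_monomial, h]

theorem toG_X_mul_X_sub_eq_zero {i j i' j' : Fin 4} (h : m i + m j = m i' + m j') :
    toG k m (X i * X j - X i' * X j') = 0 := by
  refine toG_eq_zero (n := 2) (f := 0) (Ideal.zero_mem _) ?_
  rw [map_sub, map_mul, map_mul]
  change (toRees k m (X i) : Polynomial (localRing k m)) * (toRees k m (X j)) -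
    (toRees k m (X i') : Polynomial (localRing k m)) * (toRees k m (X j')) = _
  rw [coe_toRees_X, coe_toRees_X, coe_toRees_X, coe_toRees_X, Polynomial.monomial_mul_monomial,
    Polynomial.monomial_mul_monomial, tPow_mul_tPow_eq h, sub_self, map_zero]

/-- Since m₀ d = (3a + b) d, one has m_r + a m₃ = (a + d) m₀ + m_{r-b}. The right side has a + d + 1
≥ a + 2 factors, so the product lies one step deeper in the filtration than its degree a + 1. -/
theorem toG_X_mul_X_pow_eq_zero {a b : ℕ} (hd : 0 < d)
    (hm₀ : m 0 = 3 * a + b) (hm : ∀ i : Fin 4, m i = m 0 + (i : ℕ) * d) {r : Fin 4}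
    (hr : b ≤ (r : ℕ)) : toG k m (X r * X 3 ^ a) = 0 := by
  have hlt : (r : ℕ) - b < 4 := by omega
  have key : tPow k m r * tPow k m 3 ^ a = tPow k m 0 ^ (a + d) * tPow k m ⟨r - b, hlt⟩ := by
    apply Subtype.ext
    change PowerSeries.monomial (m r) (1 : k) * PowerSeries.monomial (m 3) 1 ^ a =
      PowerSeries.monomial (m 0) 1 ^ (a + d) * PowerSeries.monomial (m _) 1
    rw [← PowerSeries.X_pow_eq, ← PowerSeries.X_pow_eq, ← PowerSeries.X_pow_eq,
      ← PowerSeries.X_pow_eq, ← pow_mul, ← pow_mul, ← pow_add, ← pow_add]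
    congr 1
    obtain ⟨q, hq⟩ := Nat.exists_eq_add_of_le hr
    have hq' : (r : ℕ) - b = q := by omega
    rw [hm r, hm 3, hm ⟨r - b, hlt⟩]
    change m 0 + r * d + (m 0 + 3 * d) * a = m 0 * (a + d) + (m 0 + (r - b : ℕ) * d)
    rw [hq', hq, hm₀]
    ring
  refine toG_eq_zero (n := a + 1) (f := tPow k m r * tPow k m 3 ^ a) ?_ ?_
  · rw [key]
    have : tPow k m 0 ^ (a + d) * tPow k m ⟨r - b, hlt⟩ ∈ maxIdeal k m ^ (a + d + 1) := by
      rw [pow_succ]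
      exact Ideal.mul_mem_mul (Ideal.pow_mem_pow (tPow_mem_maxIdeal _) _) (tPow_mem_maxIdeal _)
    exact Ideal.pow_le_pow_right (by omega) this
  · rw [map_mul, map_pow]
    change (toRees k m (X r) : Polynomial (localRing k m)) *
      (toRees k m (X 3) : Polynomial (localRing k m)) ^ a = _
    rw [coe_toRees_X, coe_toRees_X, Polynomial.monomial_pow, Polynomial.monomial_mul_monomial]
    congr 2
    omega

theorem toG_mem_gComponent (n : ℕ) (v : Fin 1 → MvPolynomial (Fin 4) k)
    (hv : v ∈ freeComponent k ![0] n) : toG k m (v 0) ∈ gComponent k m n := by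
  rw [(v 0).as_sum, map_sum]
  refine Submodule.sum_mem _ fun e he => ?_
  have hn : e.degree = n := hv 0 e (mem_support_iff.mp he)
  rw [← hn]
  have hmem : coeff e (v 0) • ∏ i, tPow k m i ^ e i ∈ maxIdeal k m ^ e.degree := by
    rw [Algebra.smul_def, Finsupp.degree_eq_sum, ← Finset.prod_pow_eq_pow_sum]
    exact Ideal.mul_mem_left _ _ (Ideal.prod_mem_prod fun i _ =>
      Ideal.pow_mem_pow (tPow_mem_maxIdeal i) _)
  exact ⟨⟨_, hmem⟩, (toG_eq_cls hmem (coe_toRees_monomial _ _)).symm⟩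

/-- The ring is k + 𝔪 and 𝔪 acts as 0 on G, so the image of the polynomial ring is an algebra over
the local ring. The Rees algebra is generated over that ring by 𝔪 T, and the image contains the
classes of the generators of 𝔪. -/
theorem surjective_toG : Function.Surjective (toG k m) := by
  have hA : ∀ f : localRing k m, algebraMap (localRing k m) (G k m) f ∈ (toG k m).range := by
    intro f
    obtain ⟨c, hc⟩ := exists_sub_algebraMap_mem_maxIdeal f
    refine ⟨C c, ?_⟩
    have h₀ : algebraMap (localRing k m) (G k m) (f - algebraMap k (localRing k m) c) = 0 :=
      Ideal.Quotient.eq_zero_iff_mem.mpr (Ideal.mem_map_of_mem _ hc)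
    rw [map_sub, sub_eq_zero] at h₀
    rw [h₀]
    exact (toG k m).commutes c
  let T : Subalgebra (localRing k m) (G k m) :=
    { (toG k m).range.toSubsemiring with algebraMap_mem' := hA }
  have hT : maxIdeal k m ≤ ((Subalgebra.toSubmodule T).comap
      (AssociatedGraded.cls (maxIdeal k m) 1)).map (Submodule.subtype _) := by
    refine Submodule.span_le.mpr ?_
    rintro _ ⟨i, rfl⟩
    exact ⟨⟨tPow k m i, by rw [pow_one]; exact tPow_mem_maxIdeal i⟩, ⟨X i, aeval_X _ i⟩, rfl⟩
  have hle : reesAlgebra (maxIdeal k m) ≤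
      (T.comap (Ideal.Quotient.mkₐ (localRing k m) ((maxIdeal k m).map
        (algebraMap (localRing k m) (reesAlgebra (maxIdeal k m)))))).map
        (reesAlgebra (maxIdeal k m)).val := by
    refine (adjoin_monomial_eq_reesAlgebra _).ge.trans (Algebra.adjoin_le ?_)
    rintro _ ⟨u, hu, rfl⟩
    obtain ⟨u', hu', rfl⟩ := hT hu
    exact ⟨_, hu', rfl⟩
  intro g
  obtain ⟨r, rfl⟩ := Ideal.Quotient.mk_surjective g
  obtain ⟨r', hr', h⟩ := hle r.2
  rw [← Subtype.ext h]
  exact hr'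

end

end MonomialCurve

/-! ### Exactness at R and the final assembly -/

namespace MonomialCurve

section

variable {k : Type*} [Field k] {m : Fin 4 → ℕ} {a b d : ℕ}

theorem toG_g₁ (hm : ∀ i : Fin 4, m i = m 0 + (i : ℕ) * d) : toG k m (g₁ k) = 0 := by
  rw [g₁, pow_two]
  refine toG_X_mul_X_sub_eq_zero ?_
  rw [hm 1, hm 2]
  change m 0 + 1 * d + (m 0 + 1 * d) = m 0 + (m 0 + 2 * d)
  ring

theorem toG_g₂ (hm : ∀ i : Fin 4, m i = m 0 + (i : ℕ) * d) : toG k m (g₂ k) = 0 := by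
  refine toG_X_mul_X_sub_eq_zero ?_
  rw [hm 1, hm 2, hm 3]
  change m 0 + 1 * d + (m 0 + 2 * d) = m 0 + (m 0 + 3 * d)
  ring

theorem toG_g₃ (hm : ∀ i : Fin 4, m i = m 0 + (i : ℕ) * d) : toG k m (g₃ k) = 0 := by
  rw [g₃, pow_two]
  refine toG_X_mul_X_sub_eq_zero ?_
  rw [hm 1, hm 2, hm 3]
  change m 0 + 2 * d + (m 0 + 2 * d) = m 0 + 1 * d + (m 0 + 3 * d)
  ring

/-- If the entries of the row `φ` are the generators of the relation ideal, then `φ` is followed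
exactly by `R → G`. -/
theorem exact_toG {r : ℕ} {φ : Matrix (Fin 1) (Fin r) (MvPolynomial (Fin 4) k)}
    (hb : 1 ≤ b ∧ b ≤ 3) (hd : 0 < d)
    (hm₀ : m 0 = 3 * a + b) (hm : ∀ i : Fin 4, m i = m 0 + (i : ℕ) * d)
    (hcop : Nat.Coprime (m 0) d) (hφ : ∀ j, toG k m (φ 0 j) = 0)
    (h₁ : ∃ j, φ 0 j = g₁ k) (h₂ : ∃ j, φ 0 j = g₂ k) (h₃ : ∃ j, φ 0 j = g₃ k)
    (h₄ : ∀ i : Fin 4, b ≤ (i : ℕ) → ∃ j, φ 0 j = X i * X 3 ^ a) :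
    Function.Exact φ.mulVecLin fun v => toG k m (v 0) := by
  intro v
  constructor
  · intro hv
    -- Identifying R¹ with R makes the range of `φ` an ideal, so the inclusion need only be checked
    -- on the generators of the relation ideal.
    have hle : relationIdeal k a b ≤ (LinearMap.range φ.mulVecLin).map (LinearMap.proj 0) := by
      have key : ∀ f, (∃ j, φ 0 j = f) →
          f ∈ (LinearMap.range φ.mulVecLin).map (LinearMap.proj 0) := by
        rintro _ ⟨j, rfl⟩
        exact ⟨_, ⟨Pi.single j 1, rfl⟩, by simp⟩
      refine Ideal.span_le.mpr ?_
      rintro f ((rfl | rfl | rfl) | ⟨i, hi, rfl⟩)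
      exacts [key _ h₁, key _ h₂, key _ h₃, key _ (h₄ i hi)]
    obtain ⟨w, hw, h⟩ := hle (mem_relationIdeal_of_toG_eq_zero hb hd hm₀ hm hcop hv)
    have : v = w := by
      ext1 i
      rw [Subsingleton.elim i 0]
      exact h.symm
    rw [this]
    exact hw
  · rintro ⟨z, rfl⟩
    change toG k m (∑ j, φ 0 j * z j) = 0
    rw [map_sum]
    refine Finset.sum_eq_zero fun j _ => ?_
    rw [map_mul, hφ j, zero_mul]

theorem coprime_of_gcd_eq_one (hm : ∀ i : Fin 4, m i = m 0 + (i : ℕ) * d)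
    (hgcd : Finset.univ.gcd m = 1) : Nat.Coprime (m 0) d := by
  refine Nat.eq_one_of_dvd_one ?_
  rw [← hgcd]
  refine Finset.dvd_gcd fun i _ => ?_
  rw [hm i]
  exact dvd_add (Nat.gcd_dvd_left _ _) ((Nat.gcd_dvd_right _ _).mul_left _)

end

end MonomialCurve

theorem corollary3p2 {k : Type*} [Field k] (a b d : ℕ) (m : Fin 4 → ℕ)
    (ha : 1 ≤ a) (hb : 1 ≤ b ∧ b ≤ 3) (hd : 0 < d)
    (hm₀ : m 0 = 3 * a + b) (hm : ∀ i : Fin 4, m i = m 0 + (i : ℕ) * d)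
    (hgcd : Finset.univ.gcd m = 1) :
    (b = 1 →
      IsMinimalGradedFreeResolution (B := G k m) (gComponent k m) (toG k m)
        ![2, 2, 2, a + 1, a + 1, a + 1]
        ![3, a + 2, 3, a + 2, a + 2, a + 2, a + 2, a + 2]
        ![a + 3, a + 3, a + 3]
        (phi₁One k a) (phi₂One k a) (phi₃One k a)) ∧
    (b = 2 →
      IsMinimalGradedFreeResolution (B := G k m) (gComponent k m) (toG k m)
        ![2, 2, 2, a + 1, a + 1]
        ![3, 3, a + 2, a + 2, a + 2]
        ![a + 4]
        (phi₁Two k a) (phi₂Two k a) (phi₃Two k a)) ∧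
    (b = 3 →
      IsMinimalGradedFreeResolution (B := G k m) (gComponent k m) (toG k m)
        ![2, 2, 2, a + 1]
        ![3, a + 3, 3, a + 3, a + 3]
        ![a + 4, a + 4]
        (phi₁Three k a) (phi₂Three k a) (phi₃Three k a)) := by
  have hcop := coprime_of_gcd_eq_one hm hgcd
  have ha₀ : a ≠ 0 := by omega
  have hmon : ∀ r : Fin 4, b ≤ (r : ℕ) → toG k m (X r * X 3 ^ a) = 0 :=
    fun r hr => toG_X_mul_X_pow_eq_zero hd hm₀ hm hr
  have hpow : toG k m (X 3 ^ (a + 1)) = 0 := by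
    rw [pow_succ']
    exact hmon 3 hb.2
  refine ⟨?_, ?_, ?_⟩
  · rintro rfl
    exact
    { homogeneous_π := toG_mem_gComponent
      homogeneous_φ₁ := mulVecLin_mem_freeComponent (isHomogeneousShift_phi₁One a)
      homogeneous_φ₂ := mulVecLin_mem_freeComponent (isHomogeneousShift_phi₂One a)
      homogeneous_φ₃ := mulVecLin_mem_freeComponent (isHomogeneousShift_phi₃One a)
      surjective_π := surjective_toG
      exact_φ₁_π := by
        refine exact_toG hb hd hm₀ hm hcop ?_ ⟨0, rfl⟩ ⟨1, rfl⟩ ⟨2, rfl⟩ ?_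
        · intro j
          fin_cases j
          exacts [toG_g₁ hm, toG_g₂ hm, toG_g₃ hm, hmon 1 le_rfl, hmon 2 (by decide), hpow]
        · intro i hi
          fin_cases i
          exacts [absurd hi (by decide), ⟨3, rfl⟩, ⟨4, rfl⟩, ⟨5, pow_succ' _ _⟩]
      exact_φ₂_φ₁ := exact_phi₂One_phi₁One a
      exact_φ₃_φ₂ := exact_phi₃One_phi₂One a
      injective_φ₃ := injective_phi₃One a
      minimal_φ₁ := range_mulVecLin_le (constantCoeff_phi₁One a)
      minimal_φ₂ := range_mulVecLin_le (constantCoeff_phi₂One ha₀)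
      minimal_φ₃ := range_mulVecLin_le (constantCoeff_phi₃One ha₀) }
  · rintro rfl
    exact
    { homogeneous_π := toG_mem_gComponent
      homogeneous_φ₁ := mulVecLin_mem_freeComponent (isHomogeneousShift_phi₁Two a)
      homogeneous_φ₂ := mulVecLin_mem_freeComponent (isHomogeneousShift_phi₂Two a)
      homogeneous_φ₃ := mulVecLin_mem_freeComponent (isHomogeneousShift_phi₃Two a)
      surjective_π := surjective_toG
      exact_φ₁_π := by
        refine exact_toG hb hd hm₀ hm hcop ?_ ⟨0, rfl⟩ ⟨1, rfl⟩ ⟨2, rfl⟩ ?_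
        · intro j
          fin_cases j
          exacts [toG_g₁ hm, toG_g₂ hm, toG_g₃ hm, hmon 2 le_rfl, hpow]
        · intro i hi
          fin_cases i
          exacts [absurd hi (by decide), absurd hi (by decide), ⟨3, rfl⟩, ⟨4, pow_succ' _ _⟩]
      exact_φ₂_φ₁ := exact_phi₂Two_phi₁Two a
      exact_φ₃_φ₂ := exact_phi₃Two_phi₂Two a
      injective_φ₃ := injective_phi₃Two a
      minimal_φ₁ := range_mulVecLin_le (constantCoeff_phi₁Two a)
      minimal_φ₂ := range_mulVecLin_le (constantCoeff_phi₂Two ha₀)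
      minimal_φ₃ := range_mulVecLin_le (constantCoeff_phi₃Two a) }
  · rintro rfl
    exact
    { homogeneous_π := toG_mem_gComponent
      homogeneous_φ₁ := mulVecLin_mem_freeComponent (isHomogeneousShift_phi₁Three a)
      homogeneous_φ₂ := mulVecLin_mem_freeComponent (isHomogeneousShift_phi₂Three a)
      homogeneous_φ₃ := mulVecLin_mem_freeComponent (isHomogeneousShift_phi₃Three a)
      surjective_π := surjective_toG
      exact_φ₁_π := by
        refine exact_toG hb hd hm₀ hm hcop ?_ ⟨0, rfl⟩ ⟨1, rfl⟩ ⟨2, rfl⟩ ?_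
        · intro j
          fin_cases j
          exacts [toG_g₁ hm, toG_g₂ hm, toG_g₃ hm, hpow]
        · intro i hi
          fin_cases i
          exacts [absurd hi (by decide), absurd hi (by decide), absurd hi (by decide),
            ⟨3, pow_succ' _ _⟩]
      exact_φ₂_φ₁ := exact_phi₂Three_phi₁Three a
      exact_φ₃_φ₂ := exact_phi₃Three_phi₂Three a
      injective_φ₃ := injective_phi₃Three a
      minimal_φ₁ := range_mulVecLin_le (constantCoeff_phi₁Three a)
      minimal_φ₂ := range_mulVecLin_le (constantCoeff_phi₂Three a)
      minimal_φ₃ := range_mulVecLin_le (constantCoeff_phi₃Three a) }
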